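/- Fix integers $\kappa, m, r \ge 0$, a finite set $\Omega$ of attacker types, and $\Omega^o := \Omega\cup\{\omega_o\}$ with $\omega_o\notin\Omega$ ($\omega_o$ is the controller of the system). Let $A\in\mathbb{R}^{m\times m}$, $B\in\mathbb{R}^{m\times r}$, let $\Sigma_1,\Sigma_w\in\mathbb{R}^{m\times m}$ be symmetric positive semi-definite, and for every $\omega\in\Omega^o$ let $Q^\omega\in\mathbb{R}^{m\times m}$ be symmetric positive semi-definite and $R^\omega\in\mathbb{R}^{r\times r}$ symmetric positive definite. Write $\|x\|_Q^2 := x'Qx$. A signaling rule $\eta\in\Upsilon$ consists of matrices $L_{k,j}\in\mathbb{R}^{m\times m}$ ($1\le j\le k\le\kappa$) and symmetric positive semi-definite matrices $\Theta_k\in\mathbb{R}^{m\times m}$ ($1\le k\le\kappa$). A control policy $\gamma\in\Gamma$ consists of Borel measurable maps $\gamma_k:(\mathbb{R}^{m})^k\to\mathbb{R}^r$ ($1\le k\le\kappa$). Given $\eta$ and $\gamma$, let $\boldsymbol{x}_1\sim\mathcal N(0,\Sigma_1)$, $\boldsymbol{w}_k\sim\mathcal N(0,\Sigma_w)$ and $\boldsymbol{\vartheta}_k\sim\mathcal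 N(0,\Theta_k)$ ($1\le k\le\kappa$) be independent (possibly degenerate) Gaussian vectors and let, for $k=1,\dots,\kappa$ (perfect measurements), $$\boldsymbol{s}_k=\sum_{j=1}^k L_{k,j}'\boldsymbol{x}_j+\boldsymbol{\vartheta}_k,\qquad \boldsymbol{u}_k=\gamma_k(\boldsymbol{s}_1,\dots,\boldsymbol{s}_k),\qquad \boldsymbol{x}_{k+1}=A\boldsymbol{x}_k+B\boldsymbol{u}_k+\boldsymbol{w}_k .$$ When type $\omega$ of the follower uses a policy $\gamma^\omega$, denote the resulting states and inputs by $\boldsymbol{x}_k^\omega,\boldsymbol{u}_k^\omega$. The cost of the type-$\omega$ follower is $$U_C^\omega(\eta,\gamma^\omega)=\sum_{k=1}^\kappa\Big(\mathbb{E}\|\boldsymbol{x}^\omega_{k+1}\|^2_{Q^\omega}+\mathbb{E}\|\boldsymbol{u}^\omega_k\|^2_{R^\omega}\Big)\in[0,\infty],$$ and the cost of the leader (the sensor) is $$U_S(\eta,\{\gamma^\omega\}_{\omega\in\Omega^o})=\max_{p\in\Delta(\Omega^o)}\Big\{\sum_{\omega\in\Omega}p_\omega\sum_{k=1}^\kappa\mathbb{E}\|\boldsymbol{x}^\omega_{k+1}\|^2_{Q^{\omega_o}}+p_{\omega_o}\sum_{k=1}^\kappa\Big(\mathbb{E}\|\boldsymbol{x}^{\omega_o}_{k+1}\|^2_{Q^{\omega_o}}+\mathbb{E}\|\boldsymbol{u}^{\omega_o}_k\|^2_{R^{\omega_o}}\Big)\Big\},$$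 where $\Delta(\Omega^o)$ is the set of probability distributions on $\Omega^o$ and $0\cdot\infty=0$. Then the leader's cost does not depend on the choice of the best responses: for every $\eta\in\Upsilon$, if $\gamma^\omega$ and $\tilde\gamma^\omega$ both minimize $U_C^\omega(\eta,\cdot)$ over $\Gamma$ for every $\omega\in\Omega^o$, then $U_S(\eta,\{\gamma^\omega\}_{\omega\in\Omega^o})=U_S(\eta,\{\tilde\gamma^\omega\}_{\omega\in\Omega^o})$. Moreover, the Stackelberg game has at least one equilibrium: there exist $\eta\in\Upsilon$ and reaction maps $\eta'\mapsto\gamma^\omega(\eta')\in\Gamma$ ($\omega\in\Omega^o$) such that $$\gamma^\omega(\eta')\in\operatorname*{arg\,min}_{\gamma\in\Gamma}U_C^\omega(\eta',\gamma)\quad\text{for all }\eta'\in\Upsilon,\ \omega\in\Omega^o,\qquad\text{and}\qquad \eta\in\operatorname*{arg\,min}_{\eta'\in\Upsilon}U_S\big(\eta',\{\gamma^\omega(\eta')\}_{\omega\in\Omega^o}\big).$$ -/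

import Mathlib

open MeasureTheory ProbabilityTheory
open scoped Matrix ENNReal

noncomputable section

namespace SensorDesign

/-- Vectors in `ℝ^d`. -/
abbrev Vec (d : ℕ) : Type := EuclideanSpace ℝ (Fin d)

/-- The squared weighted seminorm `‖x‖_Q² = x' Q x`. -/
def wsq {d : ℕ} (Q : Matrix (Fin d) (Fin d) ℝ) (x : Vec d) : ℝ :=
  x.ofLp ⬝ᵥ (Q *ᵥ x.ofLp)

/-- A linear-plus-noise signaling rule over the horizon `κ`, with perfect measurements.
Stages are numbered `0, …, κ - 1`. At stage `k` the signal is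
`s k = ∑ j ≤ k, (gain k j)' * x j + θ k` with `θ k ∼ N(0, noiseCov k)`. -/
structure SignalingRule (κ m : ℕ) where
  gain : (k : Fin κ) → Fin (k.val + 1) → Matrix (Fin m) (Fin m) ℝ
  noiseCov : Fin κ → Matrix (Fin m) (Fin m) ℝ
  noiseCov_posSemidef : ∀ k, (noiseCov k).PosSemidef

/-- A control policy: at stage `k` a Borel measurable function of the signals `s 0, …, s k`. -/
structure ControlPolicy (κ m r : ℕ) where
  act : (k : Fin κ) → (Fin (k.val + 1) → Vec m) → Vec r
  measurable_act : ∀ k, Measurable (act k)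

/-- The data of the game. The types of the follower are `Option Ω`: `some ω` is the type-`ω`
attacker and `none` is the controller of the system. -/
structure Game (κ m r : ℕ) (Ω : Type*) where
  A : Matrix (Fin m) (Fin m) ℝ
  B : Matrix (Fin m) (Fin r) ℝ
  covInit : Matrix (Fin m) (Fin m) ℝ
  covNoise : Matrix (Fin m) (Fin m) ℝ
  Q : Option Ω → Matrix (Fin m) (Fin m) ℝ
  R : Option Ω → Matrix (Fin r) (Fin r) ℝ

/-- Realizations of the primitive random variables: the initial state, the state noises, and the
noises added to the signals. -/
abbrev Sample (κ m : ℕ) : Type := Vec m × (Fin κ → Vec m) × (Fin κ → Vec m)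

variable {κ m r : ℕ} {Ω : Type*}

namespace Game

/-- The law of the primitive random variables under the signaling rule `η`: they are independent,
centered and Gaussian, with covariances `covInit`, `covNoise` and `η.noiseCov k`. -/
def law (G : Game κ m r Ω) (η : SignalingRule κ m) : Measure (Sample κ m) :=
  (multivariateGaussian 0 G.covInit).prod
    ((Measure.pi fun _ : Fin κ => multivariateGaussian 0 G.covNoise).prod
      (Measure.pi fun k : Fin κ => multivariateGaussian 0 (η.noiseCov k)))

/-- The closed-loop state after `n` stages. With `u n = γ n (s 0, …, s n)`, where
`s j = ∑ i ≤ j, (gain j i)' * x i + θ j`, it satisfies `x (n + 1) = A x n + B u n + w n`. -/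
def state (G : Game κ m r Ω) (η : SignalingRule κ m) (γ : ControlPolicy κ m r)
    (z : Sample κ m) : (n : ℕ) → n ≤ κ → Vec m
  | 0, _ => z.1
  | n + 1, h =>
    Matrix.toEuclideanLin G.A (state G η γ z n (by omega))
      + Matrix.toEuclideanLin G.B (γ.act ⟨n, h⟩ fun j : Fin (n + 1) =>
          (∑ i : Fin (j.val + 1),
            Matrix.toEuclideanLin (η.gain ⟨j.val, by omega⟩ i)ᵀ
              (state G η γ z i.val (by omega)))
            + z.2.2 ⟨j.val, by omega⟩)
      + z.2.1 ⟨n, h⟩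
termination_by n => n
decreasing_by all_goals omega

/-- The signal sent at stage `k`. -/
def signal (G : Game κ m r Ω) (η : SignalingRule κ m) (γ : ControlPolicy κ m r)
    (z : Sample κ m) (k : Fin κ) : Vec m :=
  (∑ i : Fin (k.val + 1),
    Matrix.toEuclideanLin (η.gain k i)ᵀ (G.state η γ z i.val (by omega))) + z.2.2 k

/-- The control input at stage `k`, a function of the signals up to stage `k`. -/
def control (G : Game κ m r Ω) (η : SignalingRule κ m) (γ : ControlPolicy κ m r)
    (z : Sample κ m) (k : Fin κ) : Vec r :=
  γ.act k fun j : Fin (k.val + 1) => G.signal η γ z ⟨j.val, by omega⟩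

theorem state_zero (G : Game κ m r Ω) (η : SignalingRule κ m) (γ : ControlPolicy κ m r)
    (z : Sample κ m) (h : 0 ≤ κ) : G.state η γ z 0 h = z.1 := by
  rw [state]

/-- The closed-loop dynamics. -/
theorem state_succ (G : Game κ m r Ω) (η : SignalingRule κ m) (γ : ControlPolicy κ m r)
    (z : Sample κ m) (k : Fin κ) :
    G.state η γ z (k.val + 1) k.isLt =
      Matrix.toEuclideanLin G.A (G.state η γ z k.val k.isLt.le)
        + Matrix.toEuclideanLin G.B (G.control η γ z k) + z.2.1 k := by
  rw [state]
  rfl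

/-- `∑ k, E ‖x (k + 1)‖_W²`, an element of `[0, ∞]`. -/
def stateCost (G : Game κ m r Ω) (W : Matrix (Fin m) (Fin m) ℝ) (η : SignalingRule κ m)
    (γ : ControlPolicy κ m r) : ℝ≥0∞ :=
  ∑ k : Fin κ, ∫⁻ z, ENNReal.ofReal (wsq W (G.state η γ z (k.val + 1) k.isLt)) ∂(G.law η)

/-- `∑ k, E ‖u k‖_W²`, an element of `[0, ∞]`. -/
def controlCost (G : Game κ m r Ω) (W : Matrix (Fin r) (Fin r) ℝ) (η : SignalingRule κ m)
    (γ : ControlPolicy κ m r) : ℝ≥0∞ :=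
  ∑ k : Fin κ, ∫⁻ z, ENNReal.ofReal (wsq W (G.control η γ z k)) ∂(G.law η)

/-- The objective of the type-`ω` follower. -/
def followerCost (G : Game κ m r Ω) (ω : Option Ω) (η : SignalingRule κ m)
    (γ : ControlPolicy κ m r) : ℝ≥0∞ :=
  G.stateCost (G.Q ω) η γ + G.controlCost (G.R ω) η γ

/-- The objective of the leader: the worst case over the distributions `p` of the type. -/
def leaderCost [Fintype Ω] (G : Game κ m r Ω) (η : SignalingRule κ m)
    (γ : Option Ω → ControlPolicy κ m r) : ℝ≥0∞ :=
  ⨆ p ∈ stdSimplex ℝ (Option Ω),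
    (∑ ω : Ω, ENNReal.ofReal (p (some ω)) * G.stateCost (G.Q none) η (γ (some ω)))
      + ENNReal.ofReal (p none) *
          (G.stateCost (G.Q none) η (γ none) + G.controlCost (G.R none) η (γ none))

/-- `γ` minimizes the objective of the type-`ω` follower when the leader plays `η`. -/
def IsBestResponse (G : Game κ m r Ω) (ω : Option Ω) (η : SignalingRule κ m)
    (γ : ControlPolicy κ m r) : Prop :=
  ∀ γ' : ControlPolicy κ m r, G.followerCost ω η γ ≤ G.followerCost ω η γ'

/-- Stackelberg equilibrium: `γ ω η'` is the reaction of the type-`ω` follower to the signaling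
rule `η'`; it is a best response to every `η'`, and `η` minimizes the objective of the leader
who anticipates these reactions. -/
def IsStackelbergEquilibrium [Fintype Ω] (G : Game κ m r Ω) (η : SignalingRule κ m)
    (γ : Option Ω → SignalingRule κ m → ControlPolicy κ m r) : Prop :=
  (∀ ω η', G.IsBestResponse ω η' (γ ω η')) ∧
    ∀ η', G.leaderCost η (fun ω => γ ω η) ≤ G.leaderCost η' (fun ω => γ ω η')

end Game

end SensorDesign

end

noncomputable section

namespace SensorDesign

/-! ### Second moments of random vectors -/

/-! The information of the follower does not depend on the policy. By linearity the state is a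
control-free part plus a part driven by the inputs; the driven part that enters a signal comes from
earlier inputs, which are themselves computed from earlier signals, so it can be subtracted. Hence a
policy amounts to a process adapted to the control-free signals (`measurable_input`,
`exists_policy`).

Completing squares with the Riccati recursion writes the cost of a square-integrable adapted process
as a constant plus squared norms, with positive definite weights, of its deviations from
certainty-equivalent feedback on the estimate of the control-free state (`sum_cost_eq`). Finite cost
forces square integrability because `R` is positive definite. So the feedback is optimal and optimal
inputs are almost surely unique (`input_ae_eq_of_isBestResponse`); this makes the leader's cost
independent of the chosen best responses.

Under best responses the leader's cost depends on the signaling rule only through the covariances `H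
n` of the estimates (`leaderCost_of_isBestResponse`), and is a supremum over `p` of continuous
functions of `H`. Orthogonality of projections gives `A H (n-1) A' ≤ H n ≤ freeCov n` in the
semidefinite order, with lower bound `0` at stage `0`. These constraints define a compact set, so a
minimizing `H` exists.

Conversely every such `H` is realized by a memoryless rule (`exists_signalingRule`). If `M` is the
prediction error covariance and `D = H n - A H (n-1) A'`, then `0 ≤ D ≤ M` yields `L` with `M L = D`
and `D - L' M L ≥ 0`; sending `L' x + θ` with noise covariance `D - L' M L` gives a Kalman filter
with gain one and estimate covariance `H n`. Gaussianity enters in `mom_eq_zero_of_uncorrelated`,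
which makes this linear filter optimal among all measurable estimates. -/

theorem toEuclideanLin_apply_coord {d e : ℕ} (M : Matrix (Fin e) (Fin d) ℝ) (x : Vec d)
    (i : Fin e) : Matrix.toEuclideanLin M x i = ∑ j, M i j * x j := rfl

theorem wsq_eq_sum {d : ℕ} (Q : Matrix (Fin d) (Fin d) ℝ) (x : Vec d) :
    wsq Q x = ∑ i, ∑ j, Q i j * (x j * x i) := by
  simp only [wsq, dotProduct, Matrix.mulVec, Finset.mul_sum]
  exact Finset.sum_congr rfl fun i _ => Finset.sum_congr rfl fun j _ => by ring

theorem wsq_nonneg {d : ℕ} {Q : Matrix (Fin d) (Fin d) ℝ} (hQ : Q.PosSemidef) (x : Vec d) :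
    0 ≤ wsq Q x := by
  simpa [wsq] using hQ.dotProduct_mulVec_nonneg x.ofLp

theorem eq_zero_of_wsq_eq_zero {d : ℕ} {Q : Matrix (Fin d) (Fin d) ℝ} (hQ : Q.PosDef) {x : Vec d}
    (h : wsq Q x = 0) : x = 0 := by
  by_contra hx
  have := hQ.dotProduct_mulVec_pos (x := x.ofLp) (by simpa using hx)
  simp [wsq] at h
  simp [h] at this

theorem posSemidef_of_wsq {d : ℕ} {Q : Matrix (Fin d) (Fin d) ℝ} (hs : Q.IsHermitian)
    (h : ∀ x : Vec d, 0 ≤ wsq Q x) : Q.PosSemidef :=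
  .of_dotProduct_mulVec_nonneg hs fun x => by simpa [wsq] using h (WithLp.toLp 2 x)

theorem continuous_toEuclideanLin {d e : ℕ} (M : Matrix (Fin e) (Fin d) ℝ) :
    Continuous (Matrix.toEuclideanLin M) :=
  LinearMap.continuous_of_finiteDimensional _

theorem measurable_toEuclideanLin {d e : ℕ} (M : Matrix (Fin e) (Fin d) ℝ) :
    Measurable (Matrix.toEuclideanLin M) :=
  (continuous_toEuclideanLin M).measurable

theorem toEuclideanLin_mul_apply {d e l : ℕ} (M : Matrix (Fin e) (Fin d) ℝ)
    (N : Matrix (Fin d) (Fin l) ℝ) (x : Vec l) :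
    Matrix.toEuclideanLin (M * N) x = Matrix.toEuclideanLin M (Matrix.toEuclideanLin N x) := by
  ext i
  simp [Matrix.toLpLin_apply]

section Moments

variable {S : Type*} [MeasurableSpace S] {μ : Measure S} {d e l : ℕ}

/-- The matrix of cross moments `E[f g']`. -/
def mom (μ : Measure S) (f : S → Vec d) (g : S → Vec e) : Matrix (Fin d) (Fin e) ℝ :=
  Matrix.of fun i j => ∫ z, f z i * g z j ∂μ

theorem mom_apply (f : S → Vec d) (g : S → Vec e) (i : Fin d) (j : Fin e) :
    mom μ f g i j = ∫ z, f z i * g z j ∂μ := rfl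

theorem memLp_toEuclideanLin (M : Matrix (Fin e) (Fin d) ℝ) {f : S → Vec d} (hf : MemLp f 2 μ) :
    MemLp (fun z => Matrix.toEuclideanLin M (f z)) 2 μ :=
  (LinearMap.toContinuousLinearMap (Matrix.toEuclideanLin M)).comp_memLp' hf

theorem integrable_coord_mul {f : S → Vec d} {g : S → Vec e} (hf : MemLp f 2 μ)
    (hg : MemLp g 2 μ) (i : Fin d) (j : Fin e) : Integrable (fun z => f z i * g z j) μ :=
  (hf.eval_piLp i).integrable_mul (hg.eval_piLp j)

theorem mom_transpose (f : S → Vec d) (g : S → Vec e) : (mom μ f g)ᵀ = mom μ g f := by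
  ext i j
  simp only [Matrix.transpose_apply, mom_apply, mul_comm]

theorem mom_eq_zero_comm {f : S → Vec d} {g : S → Vec e} (h : mom μ f g = 0) :
    mom μ g f = 0 := by
  rw [← mom_transpose, h, Matrix.transpose_zero]

theorem mom_zero_right (f : S → Vec d) : mom μ f (fun _ => (0 : Vec e)) = 0 := by
  ext i j
  simp [mom_apply]

theorem mom_add_left {f f' : S → Vec d} {g : S → Vec e} (hf : MemLp f 2 μ) (hf' : MemLp f' 2 μ)
    (hg : MemLp g 2 μ) : mom μ (fun z => f z + f' z) g = mom μ f g + mom μ f' g := by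
  ext i j
  simp only [mom_apply, Matrix.add_apply, PiLp.add_apply, add_mul]
  exact integral_add (integrable_coord_mul hf hg i j) (integrable_coord_mul hf' hg i j)

theorem mom_neg_left (f : S → Vec d) (g : S → Vec e) :
    mom μ (fun z => -f z) g = -mom μ f g := by
  ext i j
  simp [mom_apply, integral_neg]

theorem mom_sub_left {f f' : S → Vec d} {g : S → Vec e} (hf : MemLp f 2 μ) (hf' : MemLp f' 2 μ)
    (hg : MemLp g 2 μ) : mom μ (fun z => f z - f' z) g = mom μ f g - mom μ f' g := by
  simp only [sub_eq_add_neg]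
  have hn : MemLp (fun z => -f' z) 2 μ := hf'.neg
  rw [mom_add_left hf hn hg, mom_neg_left]

theorem mom_add_right {f : S → Vec d} {g g' : S → Vec e} (hf : MemLp f 2 μ) (hg : MemLp g 2 μ)
    (hg' : MemLp g' 2 μ) : mom μ f (fun z => g z + g' z) = mom μ f g + mom μ f g' := by
  rw [← mom_transpose, mom_add_left hg hg' hf, Matrix.transpose_add, mom_transpose, mom_transpose]

theorem mom_neg_right (f : S → Vec d) (g : S → Vec e) :
    mom μ f (fun z => -g z) = -mom μ f g := by
  rw [← mom_transpose, mom_neg_left, Matrix.transpose_neg, mom_transpose]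

theorem mom_sub_right {f : S → Vec d} {g g' : S → Vec e} (hf : MemLp f 2 μ) (hg : MemLp g 2 μ)
    (hg' : MemLp g' 2 μ) : mom μ f (fun z => g z - g' z) = mom μ f g - mom μ f g' := by
  rw [← mom_transpose, mom_sub_left hg hg' hf, Matrix.transpose_sub, mom_transpose, mom_transpose]

theorem mom_add_add {f f' : S → Vec d} {g g' : S → Vec e} (hf : MemLp f 2 μ) (hf' : MemLp f' 2 μ)
    (hg : MemLp g 2 μ) (hg' : MemLp g' 2 μ) :
    mom μ (fun z => f z + f' z) (fun z => g z + g' z) =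
      mom μ f g + mom μ f g' + (mom μ f' g + mom μ f' g') := by
  have h : MemLp (fun z => g z + g' z) 2 μ := hg.add hg'
  rw [mom_add_left hf hf' h, mom_add_right hf hg hg', mom_add_right hf' hg hg']

theorem mom_sub_sub {f f' : S → Vec d} {g g' : S → Vec e} (hf : MemLp f 2 μ) (hf' : MemLp f' 2 μ)
    (hg : MemLp g 2 μ) (hg' : MemLp g' 2 μ) :
    mom μ (fun z => f z - f' z) (fun z => g z - g' z) =
      mom μ f g - mom μ f g' - (mom μ f' g - mom μ f' g') := by
  have h : MemLp (fun z => g z - g' z) 2 μ := hg.sub hg'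
  rw [mom_sub_left hf hf' h, mom_sub_right hf hg hg', mom_sub_right hf' hg hg']

theorem mom_sum_right {ι : Type*} (s : Finset ι) {f : S → Vec d} {g : ι → S → Vec e}
    (hf : MemLp f 2 μ) (hg : ∀ i ∈ s, MemLp (g i) 2 μ) :
    mom μ f (fun z => ∑ i ∈ s, g i z) = ∑ i ∈ s, mom μ f (g i) := by
  classical
  induction s using Finset.induction_on with
  | empty => simpa using mom_zero_right f
  | insert a s ha ih =>
    simp only [Finset.sum_insert ha]
    rw [mom_add_right hf (hg a (by simp))
      (memLp_finsetSum s fun i hi => hg i (by simp [hi])), ih fun i hi => hg i (by simp [hi])]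

theorem mom_toEuclideanLin_left (M : Matrix (Fin l) (Fin d) ℝ) {f : S → Vec d} {g : S → Vec e}
    (hf : MemLp f 2 μ) (hg : MemLp g 2 μ) :
    mom μ (fun z => Matrix.toEuclideanLin M (f z)) g = M * mom μ f g := by
  ext i j
  simp only [mom_apply, toEuclideanLin_apply_coord, Matrix.mul_apply, Finset.sum_mul, mul_assoc]
  rw [integral_finsetSum _ fun k _ => (integrable_coord_mul hf hg k j).const_mul _]
  simp only [integral_const_mul]

theorem mom_toEuclideanLin_right (M : Matrix (Fin l) (Fin e) ℝ) {f : S → Vec d} {g : S → Vec e}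
    (hf : MemLp f 2 μ) (hg : MemLp g 2 μ) :
    mom μ f (fun z => Matrix.toEuclideanLin M (g z)) = mom μ f g * Mᵀ := by
  rw [← mom_transpose, mom_toEuclideanLin_left M hg hf, Matrix.transpose_mul, mom_transpose]

theorem integrable_wsq (Q : Matrix (Fin d) (Fin d) ℝ) {f : S → Vec d} (hf : MemLp f 2 μ) :
    Integrable (fun z => wsq Q (f z)) μ := by
  simp only [wsq_eq_sum]
  exact integrable_finsetSum _ fun i _ => integrable_finsetSum _ fun j _ =>
    (integrable_coord_mul hf hf j i).const_mul _

theorem integral_wsq (Q : Matrix (Fin d) (Fin d) ℝ) {f : S → Vec d} (hf : MemLp f 2 μ) :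
    ∫ z, wsq Q (f z) ∂μ = (Q * mom μ f f).trace := by
  simp only [wsq_eq_sum, Matrix.trace, Matrix.diag, Matrix.mul_apply]
  rw [integral_finsetSum Finset.univ (f := fun i z => ∑ j, Q i j * (f z j * f z i)) fun i _ =>
    integrable_finsetSum _ fun j _ => (integrable_coord_mul hf hf j i).const_mul _]
  refine Finset.sum_congr rfl fun i _ => ?_
  rw [integral_finsetSum _ fun j _ => (integrable_coord_mul hf hf j i).const_mul _]
  simp only [integral_const_mul, mom_apply]

theorem lintegral_wsq {Q : Matrix (Fin d) (Fin d) ℝ} (hQ : Q.PosSemidef) {f : S → Vec d}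
    (hf : MemLp f 2 μ) :
    ∫⁻ z, ENNReal.ofReal (wsq Q (f z)) ∂μ = ENNReal.ofReal (∫ z, wsq Q (f z) ∂μ) :=
  (ofReal_integral_eq_lintegral_ofReal (integrable_wsq Q hf)
    (Filter.Eventually.of_forall fun z => wsq_nonneg hQ (f z))).symm

theorem integral_wsq_nonneg {Q : Matrix (Fin d) (Fin d) ℝ} (hQ : Q.PosSemidef) (f : S → Vec d) :
    0 ≤ ∫ z, wsq Q (f z) ∂μ :=
  integral_nonneg fun z => wsq_nonneg hQ (f z)

theorem ae_eq_zero_of_integral_wsq_eq_zero {Q : Matrix (Fin d) (Fin d) ℝ} (hQ : Q.PosDef)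
    {f : S → Vec d} (hf : MemLp f 2 μ) (h : ∫ z, wsq Q (f z) ∂μ = 0) : f =ᵐ[μ] 0 := by
  rw [integral_eq_zero_iff_of_nonneg (fun z => wsq_nonneg hQ.posSemidef (f z))
    (integrable_wsq Q hf)] at h
  filter_upwards [h] with z hz
  exact eq_zero_of_wsq_eq_zero hQ hz

/-- Pythagoras for the weighted seminorms. -/
theorem integral_wsq_add_of_mom_eq_zero (Q : Matrix (Fin d) (Fin d) ℝ) {f g : S → Vec d}
    (hf : MemLp f 2 μ) (hg : MemLp g 2 μ) (h : mom μ f g = 0) :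
    ∫ z, wsq Q (f z + g z) ∂μ = ∫ z, wsq Q (f z) ∂μ + ∫ z, wsq Q (g z) ∂μ := by
  have hfg : MemLp (fun z => f z + g z) 2 μ := hf.add hg
  rw [integral_wsq Q hfg, integral_wsq Q hf,
    integral_wsq Q hg, mom_add_add hf hg hf hg, h, mom_eq_zero_comm h, add_zero, zero_add,
    mul_add, Matrix.trace_add]

/-- The quadratic form of the moment matrix at `x` is the mean of `wsq (x x')` along `f`, a
nonnegative integral. -/
theorem mom_self_posSemidef {f : S → Vec d} (hf : MemLp f 2 μ) : (mom μ f f).PosSemidef := by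
  refine posSemidef_of_wsq ?_ fun x => ?_
  · rw [Matrix.IsHermitian, Matrix.conjTranspose_eq_transpose_of_trivial, mom_transpose]
  · let X : Matrix (Fin d) (Fin d) ℝ := Matrix.vecMulVec x.ofLp x.ofLp
    have hX : X.PosSemidef := by
      simpa [X] using Matrix.posSemidef_vecMulVec_self_star x.ofLp
    have h := integral_wsq_nonneg (μ := μ) hX f
    rw [integral_wsq X hf] at h
    convert h using 1
    simp only [wsq_eq_sum, Matrix.trace, Matrix.diag, Matrix.mul_apply, X, Matrix.vecMulVec_apply]
    exact Finset.sum_congr rfl fun i _ => Finset.sum_congr rfl fun j _ => by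
      rw [← mom_transpose f f, Matrix.transpose_apply, mom_transpose]; ring

-- Factor `R = C' C` with `C` invertible: the integral is the squared `L²` norm of `C f`, and
-- applying `C⁻¹` returns to `f`. This lets a finite control cost imply square-integrable inputs.
open scoped MatrixOrder Matrix.Norms.L2Operator in
theorem memLp_of_lintegral_wsq_lt_top {R : Matrix (Fin d) (Fin d) ℝ} (hR : R.PosDef)
    {f : S → Vec d} (hf : Measurable f) (h : ∫⁻ z, ENNReal.ofReal (wsq R (f z)) ∂μ < ∞) :
    MemLp f 2 μ := by
  obtain ⟨C, hC⟩ : ∃ C : Matrix (Fin d) (Fin d) ℝ, R = Cᴴ * C :=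
    CStarAlgebra.nonneg_iff_eq_star_mul_self.1 hR.posSemidef.nonneg
  have hdet : IsUnit C.det := by
    have h1 := hR.det_pos
    rw [hC, Matrix.det_mul] at h1
    exact (right_ne_zero_of_mul h1.ne').isUnit
  have hsq : ∀ x : Vec d, wsq R x = ‖Matrix.toEuclideanLin C x‖ ^ 2 := fun x => by
    rw [EuclideanSpace.real_norm_sq_eq, wsq, hC, ← Matrix.mulVec_mulVec, Matrix.dotProduct_mulVec,
      Matrix.conjTranspose_eq_transpose_of_trivial, Matrix.vecMul_transpose, dotProduct]
    exact Finset.sum_congr rfl fun i _ => by rw [sq]; rfl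
  have hCf : MemLp (fun z => Matrix.toEuclideanLin C (f z)) 2 μ := by
    have hm : Measurable fun z => Matrix.toEuclideanLin C (f z) :=
      (measurable_toEuclideanLin C).comp hf
    rw [← integrable_norm_rpow_iff hm.aestronglyMeasurable (by simp) (by simp)]
    refine ⟨(hm.norm.pow_const _).aestronglyMeasurable, ?_⟩
    rw [hasFiniteIntegral_iff_ofReal (Filter.Eventually.of_forall fun z => by positivity)]
    simpa [← hsq] using h
  have := memLp_toEuclideanLin C⁻¹ hCf
  refine this.congr_norm hf.aestronglyMeasurable (Filter.Eventually.of_forall fun z => ?_)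
  simp only [← toEuclideanLin_mul_apply, Matrix.nonsing_inv_mul C hdet]
  simp

end Moments

/-- Conditional expectation as orthogonal projection. -/
theorem exists_projection {S : Type*} {𝓕 m0 : MeasurableSpace S} {μ : Measure S}
    [IsFiniteMeasure μ] (h𝓕 : 𝓕 ≤ m0) {d : ℕ} {f : S → Vec d} (hf : MemLp f 2 μ) :
    ∃ g : S → Vec d, Measurable[𝓕] g ∧ MemLp g 2 μ ∧
      ∀ (e : ℕ) (h : S → Vec e), Measurable[𝓕] h → MemLp h 2 μ →
        mom μ (fun z => f z - g z) h = 0 := by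
  let g : S → Vec d := fun z => WithLp.toLp 2 fun i => (μ[fun z => f z i | 𝓕]) z
  have hg : MemLp g 2 μ := MemLp.of_eval_piLp fun i =>
    (hf.eval_piLp i).condExp (m := 𝓕) (by norm_num)
  refine ⟨g, ?_, hg, fun e h hh hh2 => ?_⟩
  · refine (WithLp.measurable_toLp 2 _).comp (@measurable_pi_lambda _ _ _ 𝓕 _ _ fun i => ?_)
    exact stronglyMeasurable_condExp.measurable
  · rw [mom_sub_left hf hg hh2, sub_eq_zero]
    ext i j
    have hj : Measurable[𝓕] fun z => h z j :=
      (measurable_pi_apply j).comp ((WithLp.measurable_ofLp 2 _).comp hh)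
    simp only [mom_apply]
    rw [← integral_condExp h𝓕]
    exact integral_congr_ae (condExp_mul_of_stronglyMeasurable_right hj.stronglyMeasurable
      (integrable_coord_mul hf hh2 i j) ((hf.eval_piLp i).integrable (by norm_num)))

end SensorDesign

/-! ### Reduction of policies to processes adapted to the control-free signals -/

namespace SensorDesign

variable {κ m r : ℕ} {Ω : Type*}

/-- The gain `L n i`, extended by zero to all indices. -/
def SignalingRule.gainAt (η : SignalingRule κ m) (n i : ℕ) : Matrix (Fin m) (Fin m) ℝ :=
  if h : n < κ ∧ i < n + 1 then η.gain ⟨n, h.1⟩ ⟨i, h.2⟩ else 0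

/-- The state noise, extended by zero beyond the horizon. -/
def stateNoise (n : ℕ) (z : Sample κ m) : Vec m := if h : n < κ then z.2.1 ⟨n, h⟩ else 0

/-- The signal noise, extended by zero beyond the horizon. -/
def signalNoise (n : ℕ) (z : Sample κ m) : Vec m := if h : n < κ then z.2.2 ⟨n, h⟩ else 0

theorem stateNoise_of_lt {n : ℕ} (h : n < κ) :
    stateNoise (κ := κ) (m := m) n = fun z => z.2.1 ⟨n, h⟩ := by
  funext z; simp [stateNoise, h]

theorem stateNoise_of_not_lt {n : ℕ} (h : ¬n < κ) :
    stateNoise (κ := κ) (m := m) n = fun _ => 0 := by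
  funext z; simp [stateNoise, h]

theorem signalNoise_of_lt {n : ℕ} (h : n < κ) :
    signalNoise (κ := κ) (m := m) n = fun z => z.2.2 ⟨n, h⟩ := by
  funext z; simp [signalNoise, h]

theorem signalNoise_of_not_lt {n : ℕ} (h : ¬n < κ) :
    signalNoise (κ := κ) (m := m) n = fun _ => 0 := by
  funext z; simp [signalNoise, h]

theorem measurable_stateNoise (n : ℕ) : Measurable (stateNoise (κ := κ) (m := m) n) := by
  unfold stateNoise
  split_ifs <;> fun_prop

theorem measurable_signalNoise (n : ℕ) : Measurable (signalNoise (κ := κ) (m := m) n) := by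
  unfold signalNoise
  split_ifs <;> fun_prop

namespace Game

/-- The control-free state. -/
def free (G : Game κ m r Ω) : ℕ → Sample κ m → Vec m
  | 0, z => z.1
  | n + 1, z => Matrix.toEuclideanLin G.A (free G n z) + stateNoise n z

/-- The part of the state driven by the inputs `u`. -/
def driven (G : Game κ m r Ω) {S : Type*} (u : ℕ → S → Vec r) : ℕ → S → Vec m
  | 0, _ => 0
  | n + 1, z => Matrix.toEuclideanLin G.A (driven G u n z) + Matrix.toEuclideanLin G.B (u n z)

/-- The signal that would be sent if no control were applied. -/
def obs (G : Game κ m r Ω) (η : SignalingRule κ m) (n : ℕ) (z : Sample κ m) : Vec m :=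
  (∑ i ∈ Finset.range (n + 1), Matrix.toEuclideanLin (η.gainAt n i)ᵀ (G.free i z))
    + signalNoise n z

theorem free_succ (G : Game κ m r Ω) (n : ℕ) :
    G.free (n + 1) = fun z => Matrix.toEuclideanLin G.A (G.free n z) + stateNoise n z := rfl

theorem driven_succ (G : Game κ m r Ω) {S : Type*} (u : ℕ → S → Vec r) (n : ℕ) :
    G.driven u (n + 1) = fun z => Matrix.toEuclideanLin G.A (G.driven u n z) +
      Matrix.toEuclideanLin G.B (u n z) := rfl

theorem obs_eq (G : Game κ m r Ω) (η : SignalingRule κ m) (n : ℕ) :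
    G.obs η n = fun z => (∑ i ∈ Finset.range (n + 1),
      Matrix.toEuclideanLin (η.gainAt n i)ᵀ (G.free i z)) + signalNoise n z := rfl

/-- The control-free signals up to stage `n`. -/
def obsHist (G : Game κ m r Ω) (η : SignalingRule κ m) (n : ℕ) (z : Sample κ m) :
    Fin (n + 1) → Vec m := fun j => G.obs η j z

/-- The information carried by the signals up to stage `n`. -/
@[reducible] def obsAlg (G : Game κ m r Ω) (η : SignalingRule κ m) (n : ℕ) :
    MeasurableSpace (Sample κ m) :=
  MeasurableSpace.comap (G.obsHist η n) inferInstance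

/-- The inputs generated by a policy, extended by zero beyond the horizon. -/
def input (G : Game κ m r Ω) (η : SignalingRule κ m) (γ : ControlPolicy κ m r) (n : ℕ)
    (z : Sample κ m) : Vec r := if h : n < κ then G.control η γ z ⟨n, h⟩ else 0

theorem input_fin (G : Game κ m r Ω) (η : SignalingRule κ m) (γ : ControlPolicy κ m r)
    (k : Fin κ) (z : Sample κ m) : G.input η γ k z = G.control η γ z k := by
  simp [input]

theorem measurable_free (G : Game κ m r Ω) (n : ℕ) : Measurable (G.free n) := by
  induction n with
  | zero => exact measurable_fst
  | succ n ih =>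
    exact ((measurable_toEuclideanLin _).comp ih).add (measurable_stateNoise n)

theorem measurable_obs (G : Game κ m r Ω) (η : SignalingRule κ m) (n : ℕ) :
    Measurable (G.obs η n) :=
  (Finset.measurable_sum _ fun i _ => (measurable_toEuclideanLin _).comp
    (G.measurable_free i)).add (measurable_signalNoise n)

theorem measurable_obsHist (G : Game κ m r Ω) (η : SignalingRule κ m) (n : ℕ) :
    Measurable (G.obsHist η n) :=
  measurable_pi_iff.2 fun j => G.measurable_obs η j

theorem obsAlg_le (G : Game κ m r Ω) (η : SignalingRule κ m) (n : ℕ) :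
    G.obsAlg η n ≤ (inferInstance : MeasurableSpace (Sample κ m)) :=
  (G.measurable_obsHist η n).comap_le

theorem measurable_obs_of_le (G : Game κ m r Ω) (η : SignalingRule κ m) {j n : ℕ} (h : j ≤ n) :
    Measurable[G.obsAlg η n] (G.obs η j) :=
  (measurable_pi_apply (⟨j, by omega⟩ : Fin (n + 1))).comp (comap_measurable (G.obsHist η n))

theorem obsAlg_mono (G : Game κ m r Ω) (η : SignalingRule κ m) {j n : ℕ} (h : j ≤ n) :
    G.obsAlg η j ≤ G.obsAlg η n := by
  refine Measurable.comap_le ?_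
  exact @measurable_pi_lambda _ _ _ (G.obsAlg η n) _ _ fun i =>
    G.measurable_obs_of_le η (by omega)

theorem measurable_driven (G : Game κ m r Ω) {S : Type*} {𝓕 : MeasurableSpace S}
    {u : ℕ → S → Vec r} {n : ℕ} (h : ∀ i < n, Measurable[𝓕] (u i)) :
    Measurable[𝓕] (G.driven u n) := by
  induction n with
  | zero => exact measurable_const
  | succ n ih =>
    exact ((measurable_toEuclideanLin _).comp (ih fun i hi => h i (by omega))).add
      ((measurable_toEuclideanLin _).comp (h n (by omega)))

theorem driven_congr (G : Game κ m r Ω) {S : Type*} {u v : ℕ → S → Vec r} {n : ℕ} {z : S}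
    (h : ∀ i < n, u i z = v i z) : G.driven u n z = G.driven v n z := by
  induction n with
  | zero => rfl
  | succ n ih => simp only [driven, ih fun i hi => h i (by omega), h n (by omega)]

theorem state_eq (G : Game κ m r Ω) (η : SignalingRule κ m) (γ : ControlPolicy κ m r)
    (z : Sample κ m) (n : ℕ) (h : n ≤ κ) :
    G.state η γ z n h = G.free n z + G.driven (G.input η γ) n z := by
  induction n with
  | zero => simp [state_zero, free, driven]
  | succ n ih =>
    rw [G.state_succ η γ z ⟨n, h⟩, ih (by omega)]
    simp only [free, driven, map_add, input, stateNoise, dif_pos (show n < κ from h)]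
    abel

/-- The correction involves driven parts at stages up to `k`, hence only inputs before stage `k`: it
is known when the stage-`k` input is chosen. -/
theorem signal_eq (G : Game κ m r Ω) (η : SignalingRule κ m) (γ : ControlPolicy κ m r)
    (z : Sample κ m) (k : Fin κ) :
    G.signal η γ z k = G.obs η k z + ∑ i ∈ Finset.range (k.val + 1),
      Matrix.toEuclideanLin (η.gainAt k i)ᵀ (G.driven (G.input η γ) i z) := by
  have h : ∀ i : Fin (k.val + 1), η.gain k i = η.gainAt k i := fun i => by
    simp [SignalingRule.gainAt, i.isLt]
  simp only [signal, obs, state_eq, h, signalNoise, dif_pos k.isLt, map_add,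
    Finset.sum_add_distrib, ← Fin.sum_univ_eq_sum_range
      (fun i => Matrix.toEuclideanLin (η.gainAt k i)ᵀ (G.free i z)),
    ← Fin.sum_univ_eq_sum_range
      (fun i => Matrix.toEuclideanLin (η.gainAt k i)ᵀ (G.driven (G.input η γ) i z))]
  abel

/-- Every policy generates inputs that are functions of the control-free signals. -/
theorem measurable_input (G : Game κ m r Ω) (η : SignalingRule κ m) (γ : ControlPolicy κ m r)
    (n : ℕ) : Measurable[G.obsAlg η n] (G.input η γ n) := by
  induction n using Nat.strong_induction_on with
  | _ n ih =>
    by_cases h : n < κ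
    · have he : G.input η γ n = fun z => G.control η γ z ⟨n, h⟩ := by
        funext z; simp [input, h]
      rw [he]
      refine (γ.measurable_act ⟨n, h⟩).comp (@measurable_pi_lambda _ _ _ (G.obsAlg η n) _ _ ?_)
      intro j
      simp only [signal_eq]
      refine (G.measurable_obs_of_le η (by omega)).add (Finset.measurable_sum _ fun i hi => ?_)
      -- The driven part at stage `i ≤ j ≤ n` only uses inputs before `i`, which the induction
      -- hypothesis covers.
      refine (measurable_toEuclideanLin _).comp (G.measurable_driven fun i' hi' => ?_)
      have := Finset.mem_range.1 hi
      exact (ih i' (by omega)).mono (G.obsAlg_mono η (by omega)) le_rfl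
    · have he : G.input η γ n = fun _ => 0 := by
        funext z; simp [input, h]
      rw [he]
      exact measurable_const

/-- The driven part of the state, reconstructed from the signals when the inputs are the functions
`f n` of the control-free signals: entry `i` of `replay n s` is the driven part at stage `i ≤ n`. -/
def replay (G : Game κ m r Ω) (η : SignalingRule κ m)
    (f : (n : ℕ) → (Fin (n + 1) → Vec m) → Vec r) : ℕ → (ℕ → Vec m) → ℕ → Vec m
  | 0, _ => 0
  | n + 1, s => Function.update (replay G η f n s) (n + 1)
      (Matrix.toEuclideanLin G.A (replay G η f n s n) + Matrix.toEuclideanLin G.B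
        (f n fun j => s j - ∑ i ∈ Finset.range (j.val + 1),
          Matrix.toEuclideanLin (η.gainAt j i)ᵀ (replay G η f n s i)))

/-- Step `n + 1` of the recursion only overwrites entry `n + 1`, so earlier entries are final. -/
theorem replay_apply (G : Game κ m r Ω) (η : SignalingRule κ m)
    (f : (n : ℕ) → (Fin (n + 1) → Vec m) → Vec r) (s : ℕ → Vec m) {i n : ℕ} (h : i ≤ n) :
    G.replay η f n s i = G.replay η f i s i := by
  induction n with
  | zero => obtain rfl : i = 0 := by omega
            rfl
  | succ n ih =>
    rcases h.eq_or_lt with rfl | h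
    · rfl
    · rw [replay, Function.update_of_ne (by omega), ih (by omega)]

/-- The replay up to stage `n` reads only the signals before `n`. A policy that has seen the signals
up to `k` can therefore run it with any extension of them. -/
theorem replay_congr (G : Game κ m r Ω) (η : SignalingRule κ m)
    (f : (n : ℕ) → (Fin (n + 1) → Vec m) → Vec r) {s s' : ℕ → Vec m} {n : ℕ}
    (h : ∀ i < n, s i = s' i) : G.replay η f n s = G.replay η f n s' := by
  induction n with
  | zero => rfl
  | succ n ih =>
    simp only [replay, ih fun i hi => h i (by omega)]
    congr 4
    funext j
    rw [h j j.isLt]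

theorem measurable_replay (G : Game κ m r Ω) (η : SignalingRule κ m)
    {f : (n : ℕ) → (Fin (n + 1) → Vec m) → Vec r} (hf : ∀ n, Measurable (f n)) (n i : ℕ) :
    Measurable fun s => G.replay η f n s i := by
  induction n generalizing i with
  | zero => exact measurable_const
  | succ n ih =>
    by_cases hi : i = n + 1
    · subst hi
      simp only [replay, Function.update_self]
      refine ((measurable_toEuclideanLin _).comp (ih n)).add ((measurable_toEuclideanLin _).comp
        ((hf n).comp (measurable_pi_lambda _ fun j => (measurable_pi_apply _).sub
          (Finset.measurable_sum _ fun l _ => (measurable_toEuclideanLin _).comp (ih l)))))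
    · simp only [replay, Function.update_of_ne hi]
      exact ih i

/-- Every process adapted to the control-free signals is generated by a policy. -/
theorem exists_policy (G : Game κ m r Ω) (η : SignalingRule κ m) {u : ℕ → Sample κ m → Vec r}
    (hu : ∀ n, Measurable[G.obsAlg η n] (u n)) :
    ∃ γ : ControlPolicy κ m r, ∀ n < κ, G.input η γ n = u n := by
  -- Doob–Dynkin: each `u n` is a measurable function of the control-free signals.
  choose f hf hfu using fun n => (hu n).exists_eq_measurable_comp
  let ext : (n : ℕ) → (Fin (n + 1) → Vec m) → ℕ → Vec m := fun n s j =>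
    if h : j < n + 1 then s ⟨j, h⟩ else 0
  have hext : ∀ n, Measurable (ext n) := fun n => measurable_pi_lambda _ fun j => by
    simp only [ext]
    split_ifs <;> fun_prop
  -- The policy recomputes the driven part from the received signals, subtracts it, and applies `f
  -- k` to the control-free signals so recovered.
  let γ : ControlPolicy κ m r :=
    { act := fun k s => f k fun j => ext k s j - ∑ i ∈ Finset.range (j.val + 1),
        Matrix.toEuclideanLin (η.gainAt j i)ᵀ (G.replay η f k (ext k s) i)
      measurable_act := fun k => (hf k).comp (measurable_pi_lambda _ fun j =>
        ((measurable_pi_apply _).comp (hext k)).sub (Finset.measurable_sum _ fun i _ =>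
          (measurable_toEuclideanLin _).comp ((G.measurable_replay η hf k i).comp (hext k)))) }
  refine ⟨γ, ?_⟩
  let σ : Sample κ m → ℕ → Vec m := fun z j => if h : j < κ then G.signal η γ z ⟨j, h⟩ else 0
  have hinput : ∀ n (h : n < κ) z, G.input η γ n z = f n fun j => σ z j -
      ∑ i ∈ Finset.range (j.val + 1),
        Matrix.toEuclideanLin (η.gainAt j i)ᵀ (G.replay η f n (σ z) i) := by
    intro n h z
    have hσ : ∀ j < n + 1, ext n (fun j : Fin (n + 1) => G.signal η γ z ⟨j, by omega⟩) j
        = σ z j := fun j hj => by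
      simp [ext, σ, show j ≤ n by omega, show j < κ by omega]
    simp only [input, dif_pos h, control, γ]
    rw [G.replay_congr η f fun i hi => hσ i (by omega)]
    congr 1
    funext j
    rw [hσ j j.isLt]
  -- The replayed driven part is the true one in closed loop: both obey the same recursion.
  have hdriven : ∀ n ≤ κ, ∀ z, G.driven (G.input η γ) n z = G.replay η f n (σ z) n := by
    intro n
    induction n with
    | zero => intro _ z; rfl
    | succ n ih =>
      intro h z
      rw [driven, replay, Function.update_self, ih (by omega), hinput n h]
  intro n h
  funext z
  rw [hinput n h, hfu n, Function.comp_apply]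
  congr 1
  funext j
  have hj : j.val < κ := by omega
  have hσ : σ z j = G.signal η γ z ⟨j, hj⟩ := by simp [σ, hj]
  rw [hσ, signal_eq, obsHist, add_sub_assoc, add_eq_left, sub_eq_zero]
  refine Finset.sum_congr rfl fun i hi => ?_
  have := Finset.mem_range.1 hi
  rw [G.replay_apply η f (σ z) (show i ≤ n by omega), hdriven i (by omega)]

end Game

end SensorDesign

/-! ### Gaussian primitives, their moments, and linear functions of them -/

namespace SensorDesign

section Gaussian

theorem mom_map {S T : Type*} [MeasurableSpace S] [MeasurableSpace T] {μ : Measure S} {Z : S → T}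
    (hZ : Measurable Z) {d e : ℕ} {f : T → Vec d} {g : T → Vec e} (hf : Measurable f)
    (hg : Measurable g) : mom μ (fun z => f (Z z)) (fun z => g (Z z)) = mom (μ.map Z) f g := by
  ext i j
  simp only [mom_apply]
  rw [integral_map hZ.aemeasurable]
  exact (Measurable.mul (by fun_prop) (by fun_prop)).aestronglyMeasurable

theorem mom_eq_zero_of_indepFun {S : Type*} [MeasurableSpace S] {μ : Measure S} {d e : ℕ}
    {f : S → Vec d} {g : S → Vec e} (h : IndepFun f g μ) (hf : Measurable f) (hg : Measurable g)
    (h0 : ∀ i, ∫ z, f z i ∂μ = 0) : mom μ f g = 0 := by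
  ext i j
  have hij : IndepFun (fun z => f z i) (fun z => g z j) μ :=
    h.comp (φ := fun x : Vec d => x i) (ψ := fun x : Vec e => x j) (by fun_prop) (by fun_prop)
  rw [mom_apply, hij.integral_fun_mul_eq_mul_integral
    (Measurable.aestronglyMeasurable (by fun_prop)) (Measurable.aestronglyMeasurable (by fun_prop)),
    h0, zero_mul, Matrix.zero_apply]

theorem integral_coord_multivariateGaussian {d : ℕ} (S : Matrix (Fin d) (Fin d) ℝ) (i : Fin d) :
    ∫ x, x i ∂(multivariateGaussian 0 S) = 0 := by
  have h := eval_integral_piLp (μ := multivariateGaussian 0 S) (f := fun x : Vec d => x)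
    (fun i => (IsGaussian.memLp_two_id.eval_piLp i).integrable (by norm_num)) i
  rw [← h, integral_id_multivariateGaussian]
  rfl

theorem mom_multivariateGaussian {d : ℕ} {S : Matrix (Fin d) (Fin d) ℝ} (hS : S.PosSemidef) :
    mom (multivariateGaussian 0 S) (fun x => x) (fun x => x) = S := by
  ext i j
  have h : ∀ i, MemLp (fun x : Vec d => x i) 2 (multivariateGaussian 0 S) := fun i =>
    IsGaussian.memLp_two_id.eval_piLp i
  rw [← covariance_eval_multivariateGaussian (μ := 0) hS i j, covariance_eq_sub (h i) (h j),
    integral_coord_multivariateGaussian, zero_mul, sub_zero]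
  rfl

/-- Under the product measure the coordinates are independent Gaussian vectors, hence jointly
Gaussian, and their joint law is the product measure itself. -/
theorem isGaussian_pi {ι : Type*} [Fintype ι] {E : ι → Type*} [∀ i, NormedAddCommGroup (E i)]
    [∀ i, NormedSpace ℝ (E i)] [∀ i, MeasurableSpace (E i)] [∀ i, CompleteSpace (E i)]
    [∀ i, BorelSpace (E i)] [∀ i, SecondCountableTopology (E i)] (μ : ∀ i, Measure (E i))
    [∀ i, IsGaussian (μ i)] : IsGaussian (Measure.pi μ) := by
  have h := iIndepFun.hasGaussianLaw (X := fun i (x : ∀ i, E i) => x i) (P := Measure.pi μ)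
    (fun i => ⟨by
      have := (measurePreserving_eval μ i).map_eq
      rw [show (fun x : ∀ i, E i => x i) = Function.eval i from rfl, this]; infer_instance⟩)
    (iIndepFun_pi (X := fun i (x : E i) => x) fun i => aemeasurable_id)
  have := h.isGaussian_map
  rwa [show (fun (x : ∀ i, E i) i => x i) = id from rfl, Measure.map_id] at this

theorem integral_pi_multivariateGaussian {ι : Type*} [Fintype ι] {d : ℕ}
    (S : ι → Matrix (Fin d) (Fin d) ℝ) (k : ι) (i : Fin d) :
    ∫ x, x k i ∂(Measure.pi fun k => multivariateGaussian (0 : Vec d) (S k)) = 0 := by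
  have h := (measurePreserving_eval (fun k => multivariateGaussian (0 : Vec d) (S k)) k).map_eq
  rw [← integral_coord_multivariateGaussian (S k) i, ← h,
    integral_map (measurable_pi_apply k).aemeasurable
      (Measurable.aestronglyMeasurable (by fun_prop))]

theorem mom_pi_multivariateGaussian {ι : Type*} [Fintype ι] {d : ℕ}
    {S : ι → Matrix (Fin d) (Fin d) ℝ} {k : ι} (hS : (S k).PosSemidef) :
    mom (Measure.pi fun k => multivariateGaussian (0 : Vec d) (S k)) (fun x => x k) (fun x => x k)
      = S k := by
  have h := (measurePreserving_eval (fun k => multivariateGaussian (0 : Vec d) (S k)) k).map_eq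
  refine Eq.trans ?_ (mom_multivariateGaussian hS)
  rw [← h]
  exact mom_map (Z := fun x : ι → Vec d => x k) (f := fun x => x) (g := fun x => x)
    (measurable_pi_apply k) measurable_id measurable_id

theorem mom_pi_multivariateGaussian_of_ne {ι : Type*} [Fintype ι] {d : ℕ}
    (S : ι → Matrix (Fin d) (Fin d) ℝ) {k l : ι} (hkl : k ≠ l) :
    mom (Measure.pi fun k => multivariateGaussian (0 : Vec d) (S k)) (fun x => x k) (fun x => x l)
      = 0 :=
  mom_eq_zero_of_indepFun
    ((iIndepFun_pi (X := fun _ (x : Vec d) => x) fun _ => aemeasurable_id).indepFun hkl)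
    (measurable_pi_apply k) (measurable_pi_apply l)
    (fun i => integral_pi_multivariateGaussian S k i)

end Gaussian

variable {κ m r : ℕ} {Ω : Type*}

/-- Linear functions of the primitive random variables. -/
def IsLin {d : ℕ} (f : Sample κ m → Vec d) : Prop := ∃ L : Sample κ m →L[ℝ] Vec d, ∀ z, f z = L z

namespace IsLin

variable {d e : ℕ} {f g : Sample κ m → Vec d}

theorem measurable (hf : IsLin f) : Measurable f := by
  obtain ⟨L, hL⟩ := hf
  rw [funext hL]
  exact L.continuous.measurable

theorem zero : IsLin (fun _ : Sample κ m => (0 : Vec d)) := ⟨0, fun _ => rfl⟩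

theorem add (hf : IsLin f) (hg : IsLin g) : IsLin (fun z => f z + g z) := by
  obtain ⟨L, hL⟩ := hf
  obtain ⟨L', hL'⟩ := hg
  exact ⟨L + L', fun z => by simp [hL, hL']⟩

theorem sub (hf : IsLin f) (hg : IsLin g) : IsLin (fun z => f z - g z) := by
  obtain ⟨L, hL⟩ := hf
  obtain ⟨L', hL'⟩ := hg
  exact ⟨L - L', fun z => by simp [hL, hL']⟩

theorem sum {ι : Type*} (s : Finset ι) {f : ι → Sample κ m → Vec d} (hf : ∀ i, IsLin (f i)) :
    IsLin (fun z => ∑ i ∈ s, f i z) := by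
  choose L hL using hf
  exact ⟨∑ i ∈ s, L i, fun z => by simp [hL]⟩

theorem toEuclideanLin (M : Matrix (Fin e) (Fin d) ℝ) (hf : IsLin f) :
    IsLin (fun z => Matrix.toEuclideanLin M (f z)) := by
  obtain ⟨L, hL⟩ := hf
  exact ⟨(LinearMap.toContinuousLinearMap (Matrix.toEuclideanLin M)).comp L, fun z => by simp [hL]⟩

end IsLin

theorem isLin_fst : IsLin (fun z : Sample κ m => z.1) :=
  ⟨.fst ℝ _ _, fun _ => rfl⟩

theorem isLin_stateNoise (n : ℕ) : IsLin (stateNoise (κ := κ) (m := m) n) := by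
  by_cases h : n < κ
  · exact ⟨(ContinuousLinearMap.proj ⟨n, h⟩).comp
      ((ContinuousLinearMap.fst ℝ (Fin κ → Vec m) (Fin κ → Vec m)).comp
        (.snd ℝ (Vec m) _)), fun z => by simp [stateNoise, h]⟩
  · exact ⟨0, fun z => by simp [stateNoise, h]⟩

theorem isLin_signalNoise (n : ℕ) : IsLin (signalNoise (κ := κ) (m := m) n) := by
  by_cases h : n < κ
  · exact ⟨(ContinuousLinearMap.proj ⟨n, h⟩).comp
      ((ContinuousLinearMap.snd ℝ (Fin κ → Vec m) (Fin κ → Vec m)).comp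
        (.snd ℝ (Vec m) _)), fun z => by simp [signalNoise, h]⟩
  · exact ⟨0, fun z => by simp [signalNoise, h]⟩

namespace Game

variable (G : Game κ m r Ω) (η : SignalingRule κ m)

theorem isLin_free (n : ℕ) : IsLin (G.free n) := by
  induction n with
  | zero => exact isLin_fst
  | succ n ih => exact (ih.toEuclideanLin _).add (isLin_stateNoise n)

theorem isLin_obs (n : ℕ) : IsLin (G.obs η n) :=
  (IsLin.sum _ fun i => (G.isLin_free i).toEuclideanLin _).add (isLin_signalNoise n)

instance isGaussian_law : IsGaussian (G.law η) := by
  have h1 := isGaussian_pi fun _ : Fin κ => multivariateGaussian (0 : Vec m) G.covNoise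
  have h2 := isGaussian_pi fun k : Fin κ => multivariateGaussian (0 : Vec m) (η.noiseCov k)
  unfold law
  infer_instance

theorem integral_law : ∫ z, z ∂(G.law η) = 0 := by
  have h1 := isGaussian_pi fun _ : Fin κ => multivariateGaussian (0 : Vec m) G.covNoise
  have h2 := isGaussian_pi fun k : Fin κ => multivariateGaussian (0 : Vec m) (η.noiseCov k)
  have hi : Integrable (fun z => z) (G.law η) := IsGaussian.integrable_id
  have hpi : ∀ S : Fin κ → Matrix (Fin m) (Fin m) ℝ,
      ∫ x, x ∂(Measure.pi fun k => multivariateGaussian (0 : Vec m) (S k)) = 0 := fun S => by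
    have h := isGaussian_pi fun k => multivariateGaussian (0 : Vec m) (S k)
    have hS : Integrable (fun x => x)
        (Measure.pi fun k => multivariateGaussian (0 : Vec m) (S k)) :=
      IsGaussian.integrable_id
    funext k
    rw [eval_integral fun k => hS.eval k]
    ext i
    rw [eval_integral_piLp fun i => (hS.eval k).eval_piLp i, integral_pi_multivariateGaussian]
    rfl
  have hsnd : ∫ z : (Fin κ → Vec m) × (Fin κ → Vec m), z
      ∂((Measure.pi fun _ : Fin κ => multivariateGaussian (0 : Vec m) G.covNoise).prod
        (Measure.pi fun k : Fin κ => multivariateGaussian (0 : Vec m) (η.noiseCov k))) = 0 := by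
    have hi : Integrable (fun z => z)
      ((Measure.pi fun _ : Fin κ => multivariateGaussian (0 : Vec m) G.covNoise).prod
        (Measure.pi fun k : Fin κ => multivariateGaussian (0 : Vec m) (η.noiseCov k))) :=
      IsGaussian.integrable_id
    refine Prod.ext ?_ ?_
    · rw [fst_integral hi, integral_fun_fst (fun x => x), hpi, smul_zero]
      rfl
    · rw [snd_integral hi, integral_fun_snd (fun x => x), hpi, smul_zero]
      rfl
  refine Prod.ext ?_ ?_
  · rw [fst_integral hi, law, integral_fun_fst (fun x => x), integral_id_multivariateGaussian,
      smul_zero]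
    rfl
  · rw [snd_integral hi, law, integral_fun_snd (fun x => x), hsnd, smul_zero]
    rfl

variable {G η}

theorem memLp_of_isLin {d : ℕ} {f : Sample κ m → Vec d} (hf : IsLin f) : MemLp f 2 (G.law η) := by
  obtain ⟨L, hL⟩ := hf
  rw [funext hL]
  exact (IsGaussian.hasGaussianLaw_id.map_fun L).memLp_two

theorem integral_of_isLin {d : ℕ} {f : Sample κ m → Vec d} (hf : IsLin f) (i : Fin d) :
    ∫ z, f z i ∂(G.law η) = 0 := by
  have hfm := (memLp_of_isLin (G := G) (η := η) hf).integrable (by norm_num)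
  obtain ⟨L, hL⟩ := hf
  rw [← eval_integral_piLp fun i => hfm.eval_piLp i, funext hL,
    L.integral_comp_comm (φ := fun z => z) IsGaussian.integrable_id, integral_law, map_zero]
  rfl

/-- A linear function of the primitives that is uncorrelated with the control-free signals is
orthogonal to all square-integrable functions of these signals. -/
theorem mom_eq_zero_of_uncorrelated {d e n : ℕ} {f : Sample κ m → Vec d} {h : Sample κ m → Vec e}
    (hf : IsLin f) (hfy : ∀ j ≤ n, mom (G.law η) f (G.obs η j) = 0)
    (hh : Measurable[G.obsAlg η n] h) : mom (G.law η) f h = 0 := by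
  obtain ⟨g, hg, rfl⟩ := hh.exists_eq_measurable_comp
  have hfm := hf.measurable
  have hcov : ∀ (i : Fin d) (p : Fin (n + 1) × Fin m),
      cov[fun z => f z i, fun z => G.obs η p.1 z p.2; G.law η] = 0 := fun i p => by
    rw [covariance_eq_sub ((memLp_of_isLin hf).eval_piLp i)
      ((memLp_of_isLin (G.isLin_obs η p.1)).eval_piLp p.2), integral_of_isLin hf, zero_mul,
      sub_zero]
    exact congrFun (congrFun (hfy p.1 (by omega)) i) p.2
  -- The pair of `f` and the signals is a linear image of one Gaussian vector, so being uncorrelated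
  -- gives independence. With `f` centered this yields the claim without integrability of `h`.
  have hgauss : HasGaussianLaw (fun z => ((fun i => f z i : Fin d → ℝ),
      (fun p => G.obs η p.1 z p.2 : Fin (n + 1) × Fin m → ℝ))) (G.law η) := by
    obtain ⟨L, hL⟩ := hf
    choose Ly hLy using G.isLin_obs η
    have := (IsGaussian.hasGaussianLaw_id (μ := G.law η)).map_fun
      ((ContinuousLinearMap.pi fun i : Fin d => (EuclideanSpace.proj i : Vec d →L[ℝ] ℝ).comp L).prod
        (ContinuousLinearMap.pi fun p : Fin (n + 1) × Fin m =>
          (EuclideanSpace.proj p.2 : Vec m →L[ℝ] ℝ).comp (Ly p.1)))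
    simpa [hL, hLy] using this
  have hind := hgauss.indepFun_of_covariance_eval hcov
  refine mom_eq_zero_of_indepFun ?_ hfm (hg.comp (G.measurable_obsHist η n))
    (integral_of_isLin hf)
  exact hind.comp (φ := fun x => (WithLp.toLp 2 x : Vec d))
    (ψ := fun y : Fin (n + 1) × Fin m → ℝ => g fun j => WithLp.toLp 2 fun l => y (j, l))
    (WithLp.measurable_toLp 2 _) (hg.comp (measurable_pi_lambda _ fun j =>
      (WithLp.measurable_toLp 2 _).comp (measurable_pi_lambda _ fun l => measurable_pi_apply _)))

theorem mom_fst_fst (hInit : G.covInit.PosSemidef) :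
    mom (G.law η) (fun z => z.1) (fun z => z.1) = G.covInit := by
  have h := isGaussian_pi fun _ : Fin κ => multivariateGaussian (0 : Vec m) G.covNoise
  have h2 := isGaussian_pi fun k : Fin κ => multivariateGaussian (0 : Vec m) (η.noiseCov k)
  rw [mom_map (f := fun x => x) (g := fun x => x) measurable_fst measurable_id measurable_id,
    law, measurePreserving_fst.map_eq, mom_multivariateGaussian hInit]

theorem mom_fst_of_snd {e : ℕ} {g : (Fin κ → Vec m) × (Fin κ → Vec m) → Vec e}
    (hg : Measurable g) : mom (G.law η) (fun z => z.1) (fun z => g z.2) = 0 := by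
  have h := isGaussian_pi fun _ : Fin κ => multivariateGaussian (0 : Vec m) G.covNoise
  have h2 := isGaussian_pi fun k : Fin κ => multivariateGaussian (0 : Vec m) (η.noiseCov k)
  exact mom_eq_zero_of_indepFun (indepFun_prod measurable_id hg) measurable_fst
    (hg.comp measurable_snd) (integral_of_isLin isLin_fst)

theorem mom_of_snd {d e : ℕ} {f : (Fin κ → Vec m) × (Fin κ → Vec m) → Vec d}
    {g : (Fin κ → Vec m) × (Fin κ → Vec m) → Vec e} (hf : Measurable f) (hg : Measurable g) :
    mom (G.law η) (fun z => f z.2) (fun z => g z.2) =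
      mom ((Measure.pi fun _ : Fin κ => multivariateGaussian 0 G.covNoise).prod
        (Measure.pi fun k : Fin κ => multivariateGaussian 0 (η.noiseCov k))) f g := by
  have h := isGaussian_pi fun _ : Fin κ => multivariateGaussian (0 : Vec m) G.covNoise
  have h2 := isGaussian_pi fun k : Fin κ => multivariateGaussian (0 : Vec m) (η.noiseCov k)
  rw [mom_map (Z := Prod.snd) (f := f) (g := g) measurable_snd hf hg, law,
    measurePreserving_snd.map_eq]

theorem mom_fst_stateNoise (n : ℕ) : mom (G.law η) (fun z => z.1) (stateNoise n) = 0 := by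
  by_cases h : n < κ
  · rw [stateNoise_of_lt h]
    exact mom_fst_of_snd (g := fun x => x.1 ⟨n, h⟩) (by fun_prop)
  · rw [stateNoise_of_not_lt h]
    exact mom_zero_right _

theorem mom_fst_signalNoise (n : ℕ) : mom (G.law η) (fun z => z.1) (signalNoise n) = 0 := by
  by_cases h : n < κ
  · rw [signalNoise_of_lt h]
    exact mom_fst_of_snd (g := fun x => x.2 ⟨n, h⟩) (by fun_prop)
  · rw [signalNoise_of_not_lt h]
    exact mom_zero_right _

theorem mom_stateNoise_signalNoise (k n : ℕ) :
    mom (G.law η) (stateNoise k) (signalNoise n) = 0 := by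
  have h1 := isGaussian_pi fun _ : Fin κ => multivariateGaussian (0 : Vec m) G.covNoise
  have h2 := isGaussian_pi fun k : Fin κ => multivariateGaussian (0 : Vec m) (η.noiseCov k)
  by_cases h : n < κ
  · by_cases hk : k < κ
    · rw [signalNoise_of_lt h, stateNoise_of_lt hk, mom_of_snd (f := fun x => x.1 ⟨k, hk⟩)
        (g := fun x => x.2 ⟨n, h⟩) (by fun_prop)
        (by fun_prop)]
      refine mom_eq_zero_of_indepFun (indepFun_prod (X := fun x : Fin κ → Vec m => x ⟨k, hk⟩)
        (Y := fun x : Fin κ → Vec m => x ⟨n, h⟩) (by fun_prop) (by fun_prop)) (by fun_prop) (by fun_prop)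
        fun i => ?_
      rw [integral_fun_fst (fun x : Fin κ → Vec m => x ⟨k, hk⟩ i),
        integral_pi_multivariateGaussian, smul_zero]
    · rw [stateNoise_of_not_lt hk]
      exact mom_eq_zero_comm (mom_zero_right _)
  · rw [signalNoise_of_not_lt h]
    exact mom_zero_right _

theorem mom_stateNoise_of_ne {k n : ℕ} (hkn : k ≠ n) :
    mom (G.law η) (stateNoise k) (stateNoise n) = 0 := by
  have h1 := isGaussian_pi fun _ : Fin κ => multivariateGaussian (0 : Vec m) G.covNoise
  have h2 := isGaussian_pi fun k : Fin κ => multivariateGaussian (0 : Vec m) (η.noiseCov k)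
  by_cases h : n < κ
  · by_cases hk : k < κ
    · rw [stateNoise_of_lt h, stateNoise_of_lt hk]
      rw [mom_of_snd (f := fun x => x.1 ⟨k, hk⟩) (g := fun x => x.1 ⟨n, h⟩) (by fun_prop)
        (by fun_prop), mom_map (Z := Prod.fst) (f := fun x : Fin κ → Vec m => x ⟨k, hk⟩)
        (g := fun x : Fin κ → Vec m => x ⟨n, h⟩)
        measurable_fst (by fun_prop) (by fun_prop), measurePreserving_fst.map_eq]
      exact mom_pi_multivariateGaussian_of_ne (fun _ => G.covNoise) (by simpa using hkn)
    · rw [stateNoise_of_not_lt hk]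
      exact mom_eq_zero_comm (mom_zero_right _)
  · rw [stateNoise_of_not_lt h]
    exact mom_zero_right _

theorem mom_stateNoise_self (hNoise : G.covNoise.PosSemidef) {n : ℕ} (h : n < κ) :
    mom (G.law η) (stateNoise n) (stateNoise n) = G.covNoise := by
  have h1 := isGaussian_pi fun _ : Fin κ => multivariateGaussian (0 : Vec m) G.covNoise
  have h2 := isGaussian_pi fun k : Fin κ => multivariateGaussian (0 : Vec m) (η.noiseCov k)
  rw [stateNoise_of_lt h]
  rw [mom_of_snd (f := fun x => x.1 ⟨n, h⟩) (g := fun x => x.1 ⟨n, h⟩) (by fun_prop)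
    (by fun_prop), mom_map (Z := Prod.fst) (f := fun x : Fin κ → Vec m => x ⟨n, h⟩)
        (g := fun x : Fin κ → Vec m => x ⟨n, h⟩)
    measurable_fst (by fun_prop) (by fun_prop), measurePreserving_fst.map_eq]
  exact mom_pi_multivariateGaussian (S := fun _ => G.covNoise) hNoise

theorem mom_signalNoise_of_ne {k n : ℕ} (hkn : k ≠ n) :
    mom (G.law η) (signalNoise k) (signalNoise n) = 0 := by
  have h1 := isGaussian_pi fun _ : Fin κ => multivariateGaussian (0 : Vec m) G.covNoise
  have h2 := isGaussian_pi fun k : Fin κ => multivariateGaussian (0 : Vec m) (η.noiseCov k)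
  by_cases h : n < κ
  · by_cases hk : k < κ
    · rw [signalNoise_of_lt h, signalNoise_of_lt hk]
      rw [mom_of_snd (f := fun x => x.2 ⟨k, hk⟩) (g := fun x => x.2 ⟨n, h⟩) (by fun_prop)
        (by fun_prop), mom_map (Z := Prod.snd) (f := fun x : Fin κ → Vec m => x ⟨k, hk⟩)
        (g := fun x : Fin κ → Vec m => x ⟨n, h⟩)
        measurable_snd (by fun_prop) (by fun_prop), measurePreserving_snd.map_eq]
      exact mom_pi_multivariateGaussian_of_ne η.noiseCov (by simpa using hkn)
    · rw [signalNoise_of_not_lt hk]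
      exact mom_eq_zero_comm (mom_zero_right _)
  · rw [signalNoise_of_not_lt h]
    exact mom_zero_right _

theorem mom_signalNoise_self {n : ℕ} (h : n < κ) :
    mom (G.law η) (signalNoise n) (signalNoise n) = η.noiseCov ⟨n, h⟩ := by
  have h1 := isGaussian_pi fun _ : Fin κ => multivariateGaussian (0 : Vec m) G.covNoise
  have h2 := isGaussian_pi fun k : Fin κ => multivariateGaussian (0 : Vec m) (η.noiseCov k)
  rw [signalNoise_of_lt h]
  rw [mom_of_snd (f := fun x => x.2 ⟨n, h⟩) (g := fun x => x.2 ⟨n, h⟩) (by fun_prop)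
    (by fun_prop), mom_map (Z := Prod.snd) (f := fun x : Fin κ → Vec m => x ⟨n, h⟩)
        (g := fun x : Fin κ → Vec m => x ⟨n, h⟩)
    measurable_snd (by fun_prop) (by fun_prop), measurePreserving_snd.map_eq]
  exact mom_pi_multivariateGaussian (η.noiseCov_posSemidef ⟨n, h⟩)

/-- The control-free state at stage `n` contains only the noises of stages before `n`, whence `n ≤
k` and not `n < k`. -/
theorem mom_free_stateNoise {n k : ℕ} (h : n ≤ k) :
    mom (G.law η) (G.free n) (stateNoise k) = 0 := by
  have hw := memLp_of_isLin (G := G) (η := η) (isLin_stateNoise k)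
  induction n with
  | zero => exact mom_fst_stateNoise k
  | succ n ih =>
    have hx := memLp_of_isLin (G := G) (η := η) (G.isLin_free n)
    rw [free_succ]
    rw [mom_add_left (memLp_toEuclideanLin _ hx) (memLp_of_isLin (isLin_stateNoise n)) hw,
      mom_toEuclideanLin_left _ hx hw, ih (by omega), mom_stateNoise_of_ne (by omega), mul_zero,
      add_zero]

theorem mom_free_signalNoise (n k : ℕ) : mom (G.law η) (G.free n) (signalNoise k) = 0 := by
  have hw := memLp_of_isLin (G := G) (η := η) (isLin_signalNoise k)
  induction n with
  | zero => exact mom_fst_signalNoise k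
  | succ n ih =>
    have hx := memLp_of_isLin (G := G) (η := η) (G.isLin_free n)
    rw [free_succ]
    rw [mom_add_left (memLp_toEuclideanLin _ hx) (memLp_of_isLin (isLin_stateNoise n)) hw,
      mom_toEuclideanLin_left _ hx hw, ih, mom_stateNoise_signalNoise, mul_zero, add_zero]

theorem mom_obs_of_mom_free {e n : ℕ} {f : Sample κ m → Vec e} (hf : IsLin f)
    (h : ∀ i ≤ n, mom (G.law η) f (G.free i) = 0) (hs : mom (G.law η) f (signalNoise n) = 0) :
    mom (G.law η) f (G.obs η n) = 0 := by
  have hx := fun i => memLp_of_isLin (G := G) (η := η) (G.isLin_free i)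
  have hF := memLp_of_isLin (G := G) (η := η) hf
  rw [obs_eq]
  rw [mom_add_right hF (memLp_finsetSum _ fun i _ => memLp_toEuclideanLin _ (hx i))
    (memLp_of_isLin (isLin_signalNoise n)), hs, add_zero,
    mom_sum_right _ hF fun i _ => memLp_toEuclideanLin _ (hx i)]
  refine Finset.sum_eq_zero fun i hi => ?_
  have := Finset.mem_range.1 hi
  rw [mom_toEuclideanLin_right _ hF (hx i), h i (by omega), Matrix.zero_mul]

/-- The state noise is orthogonal to functions of the past signals. -/
theorem mom_stateNoise_adapted {e n k : ℕ} (hnk : n ≤ k) {h : Sample κ m → Vec e}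
    (hh : Measurable[G.obsAlg η n] h) : mom (G.law η) (stateNoise k) h = 0 :=
  mom_eq_zero_of_uncorrelated (isLin_stateNoise k) (fun _ hj =>
    mom_obs_of_mom_free (isLin_stateNoise k)
      (fun _ hi => mom_eq_zero_comm (mom_free_stateNoise (by omega)))
      (mom_stateNoise_signalNoise _ _)) hh

end Game

end SensorDesign

/-! ### Completion of squares and the Riccati recursion -/

namespace SensorDesign

variable {κ m r : ℕ} {Ω : Type*}

namespace Game

section Riccati

variable (G : Game κ m r Ω) (R : Matrix (Fin r) (Fin r) ℝ) (N : Matrix (Fin m) (Fin m) ℝ)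

/-- The weight of the input in the completed square. -/
def inputWeight : Matrix (Fin r) (Fin r) ℝ := R + G.Bᵀ * N * G.B

/-- The feedback gain of the linear-quadratic regulator. -/
def lqGain : Matrix (Fin r) (Fin m) ℝ := (G.inputWeight R N)⁻¹ * (G.Bᵀ * N * G.A)

/-- One step of the Riccati recursion. -/
def riccatiStep : Matrix (Fin m) (Fin m) ℝ :=
  G.Aᵀ * N * G.A - (G.Bᵀ * N * G.A)ᴴ * (G.inputWeight R N)⁻¹ * (G.Bᵀ * N * G.A)

variable {R N}

theorem inputWeight_posDef (hR : R.PosDef) (hN : N.PosSemidef) : (G.inputWeight R N).PosDef :=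
  hR.add_posSemidef (by simpa using hN.conjTranspose_mul_mul_same G.B)

/-- The left side is a quadratic form in `(u, x)` whose block matrix has `inputWeight` as its `u`
corner. Eliminating `u` by the Schur complement leaves `riccatiStep`. -/
theorem complete_square (hR : R.PosDef) (hN : N.PosSemidef) (x : Vec m) (u : Vec r) :
    wsq N (Matrix.toEuclideanLin G.A x + Matrix.toEuclideanLin G.B u) + wsq R u =
      wsq (G.inputWeight R N) (u + Matrix.toEuclideanLin (G.lqGain R N) x) +
        wsq (G.riccatiStep R N) x := by
  have hΔ := G.inputWeight_posDef hR hN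
  have : Invertible (G.inputWeight R N) := hΔ.isUnit.invertible
  have h := Matrix.schur_complement_eq₁₁ (G.Bᵀ * N * G.A) (G.Aᵀ * N * G.A) u.ofLp x.ofLp
    hΔ.isHermitian
  have hN' : Nᵀ = N := by simpa using hN.isHermitian.eq
  simp only [star_trivial, ← Matrix.dotProduct_mulVec] at h
  have h2 : wsq (G.inputWeight R N) (u + Matrix.toEuclideanLin (G.lqGain R N) x) +
        wsq (G.riccatiStep R N) x = Sum.elim u.ofLp x.ofLp ⬝ᵥ
      Matrix.fromBlocks (G.inputWeight R N) (G.Bᵀ * N * G.A) (G.Bᵀ * N * G.A)ᴴ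
        (G.Aᵀ * N * G.A) *ᵥ Sum.elim u.ofLp x.ofLp := h.symm
  rw [h2]
  simp only [wsq, inputWeight, Matrix.dotProduct_mulVec, Matrix.vecMul_fromBlocks,
    Matrix.toLpLin_apply, WithLp.ofLp_add, Matrix.add_vecMul, Matrix.vecMul_add,
    Matrix.vecMul_mulVec, Matrix.vecMul_vecMul, add_dotProduct, dotProduct_add,
    Matrix.conjTranspose_eq_transpose_of_trivial, Matrix.transpose_mul, Matrix.transpose_transpose,
    hN', sumElim_dotProduct_sumElim, Sum.elim_comp_inl, Sum.elim_comp_inr, Matrix.mul_assoc]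
  ring

theorem riccatiStep_posSemidef (hR : R.PosDef) (hN : N.PosSemidef) :
    (G.riccatiStep R N).PosSemidef := by
  refine posSemidef_of_wsq ?_ fun x => ?_
  · have h1 : (G.inputWeight R N)⁻¹ᴴ = (G.inputWeight R N)⁻¹ :=
      (G.inputWeight_posDef hR hN).isHermitian.inv
    have h2 : (G.Aᵀ * N * G.A).IsHermitian := by
      simpa using (hN.conjTranspose_mul_mul_same G.A).isHermitian
    exact h2.sub (Matrix.isHermitian_conjTranspose_mul_mul _ h1)
  -- The input `-K x` kills the square, so the Riccati form is a sum of two nonnegative costs.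
  · have h := G.complete_square hR hN x (-Matrix.toEuclideanLin (G.lqGain R N) x)
    rw [neg_add_cancel, show wsq (G.inputWeight R N) 0 = 0 by simp [wsq], zero_add] at h
    rw [← h]
    exact add_nonneg (wsq_nonneg hN _) (wsq_nonneg hR.posSemidef _)

end Riccati

/-! ### Optimal inputs of a follower and their almost sure uniqueness -/

section Follower

variable (G : Game κ m r Ω) (η : SignalingRule κ m) (ω : Option Ω)

/-- The Riccati recursion for the type-`ω` follower, in the number of remaining stages. -/
def riccati : ℕ → Matrix (Fin m) (Fin m) ℝ
  | 0 => 0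
  | j + 1 => G.riccatiStep (G.R ω) (G.Q ω + riccati j)

/-- The weight of the successor state at stage `n`, including the cost to go. -/
def stateWeight (n : ℕ) : Matrix (Fin m) (Fin m) ℝ := G.Q ω + G.riccati ω (κ - (n + 1))

/-- The weight of the input in the completed square of stage `n`. -/
def stageWeight (n : ℕ) : Matrix (Fin r) (Fin r) ℝ := G.inputWeight (G.R ω) (G.stateWeight ω n)

/-- The optimal feedback gain of stage `n`. -/
def stageGain (n : ℕ) : Matrix (Fin r) (Fin m) ℝ := G.lqGain (G.R ω) (G.stateWeight ω n)

variable {ω}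

theorem riccati_posSemidef (hQ : (G.Q ω).PosSemidef) (hR : (G.R ω).PosDef) (j : ℕ) :
    (G.riccati ω j).PosSemidef := by
  induction j with
  | zero => exact Matrix.PosSemidef.zero
  | succ j ih => exact G.riccatiStep_posSemidef hR (hQ.add ih)

theorem stateWeight_posSemidef (hQ : (G.Q ω).PosSemidef) (hR : (G.R ω).PosDef) (n : ℕ) :
    (G.stateWeight ω n).PosSemidef :=
  hQ.add (G.riccati_posSemidef hQ hR _)

theorem stageWeight_posDef (hQ : (G.Q ω).PosSemidef) (hR : (G.R ω).PosDef) (n : ℕ) :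
    (G.stageWeight ω n).PosDef :=
  G.inputWeight_posDef hR (G.stateWeight_posSemidef hQ hR n)

theorem exists_estimate (n : ℕ) :
    ∃ g : Sample κ m → Vec m, Measurable[G.obsAlg η n] g ∧ MemLp g 2 (G.law η) ∧
      ∀ (e : ℕ) (h : Sample κ m → Vec e), Measurable[G.obsAlg η n] h → MemLp h 2 (G.law η) →
        mom (G.law η) (fun z => G.free n z - g z) h = 0 :=
  exists_projection (G.obsAlg_le η n) (memLp_of_isLin (G.isLin_free n))

/-- The estimate of the control-free state given the signals up to the current stage. -/
def estimate (n : ℕ) : Sample κ m → Vec m := (G.exists_estimate η n).choose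

theorem measurable_estimate (n : ℕ) : Measurable[G.obsAlg η n] (G.estimate η n) :=
  (G.exists_estimate η n).choose_spec.1

theorem memLp_estimate (n : ℕ) : MemLp (G.estimate η n) 2 (G.law η) :=
  (G.exists_estimate η n).choose_spec.2.1

theorem mom_sub_estimate (n : ℕ) {e : ℕ} {h : Sample κ m → Vec e}
    (hh : Measurable[G.obsAlg η n] h) (hh2 : MemLp h 2 (G.law η)) :
    mom (G.law η) (fun z => G.free n z - G.estimate η n z) h = 0 :=
  (G.exists_estimate η n).choose_spec.2.2 e h hh hh2

theorem memLp_free (n : ℕ) : MemLp (G.free n) 2 (G.law η) := memLp_of_isLin (G.isLin_free n)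

theorem memLp_stateNoise (n : ℕ) : MemLp (stateNoise n) 2 (G.law η) :=
  memLp_of_isLin (isLin_stateNoise n)

theorem memLp_driven {S : Type*} [MeasurableSpace S] {μ : Measure S} {u : ℕ → S → Vec r}
    (hu : ∀ n, MemLp (u n) 2 μ) (n : ℕ) : MemLp (G.driven u n) 2 μ := by
  induction n with
  | zero => exact MemLp.zero
  | succ n ih => exact (memLp_toEuclideanLin _ ih).add (memLp_toEuclideanLin _ (hu n))

/-- The driven part at stage `k + 1` stops at the input of stage `k`, so the signals up to `k`
determine it. -/
theorem measurable_driven_obsAlg {u : ℕ → Sample κ m → Vec r}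
    (hu : ∀ n, Measurable[G.obsAlg η n] (u n)) {n k : ℕ} (h : n ≤ k + 1) :
    Measurable[G.obsAlg η k] (G.driven u n) :=
  G.measurable_driven fun i hi => (hu i).mono (G.obsAlg_mono η (by omega)) le_rfl

/-- The closed-loop state under the inputs `u`. -/
def traj (u : ℕ → Sample κ m → Vec r) (n : ℕ) (z : Sample κ m) : Vec m :=
  G.free n z + G.driven u n z

theorem traj_succ (u : ℕ → Sample κ m → Vec r) (n : ℕ) (z : Sample κ m) :
    G.traj u (n + 1) z = (Matrix.toEuclideanLin G.A (G.traj u n z) +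
      Matrix.toEuclideanLin G.B (u n z)) + stateNoise n z := by
  simp only [traj, free, driven, map_add]
  abel

variable {G η}

theorem memLp_traj {u : ℕ → Sample κ m → Vec r} (hu : ∀ n, MemLp (u n) 2 (G.law η)) (n : ℕ) :
    MemLp (G.traj u n) 2 (G.law η) :=
  (G.memLp_free η n).add (G.memLp_driven hu n)

theorem mom_stateNoise_traj {u : ℕ → Sample κ m → Vec r}
    (hu : ∀ n, Measurable[G.obsAlg η n] (u n)) (hu2 : ∀ n, MemLp (u n) 2 (G.law η)) (n : ℕ) :
    mom (G.law η) (stateNoise n) (G.traj u n) = 0 := by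
  rw [show G.traj u n = fun z => G.free n z + G.driven u n z from rfl,
    mom_add_right (G.memLp_stateNoise η n) (G.memLp_free η n) (G.memLp_driven hu2 n),
    mom_eq_zero_comm (mom_free_stateNoise le_rfl),
    mom_stateNoise_adapted le_rfl (G.measurable_driven_obsAlg η hu (by omega)), add_zero]

/-- The noise of stage `n` is uncorrelated with `A x + B u`, so its cost splits off by Pythagoras;
the remainder is completed to a square pointwise. -/
theorem integral_stage (hQ : (G.Q ω).PosSemidef) (hR : (G.R ω).PosDef)
    {u : ℕ → Sample κ m → Vec r} (hu : ∀ n, Measurable[G.obsAlg η n] (u n))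
    (hu2 : ∀ n, MemLp (u n) 2 (G.law η)) (n : ℕ) :
    ∫ z, wsq (G.stateWeight ω n) (G.traj u (n + 1) z) ∂(G.law η)
        + ∫ z, wsq (G.R ω) (u n z) ∂(G.law η) =
      ∫ z, wsq (G.stageWeight ω n) (u n z + Matrix.toEuclideanLin (G.stageGain ω n) (G.traj u n z))
          ∂(G.law η)
        + ∫ z, wsq (G.riccatiStep (G.R ω) (G.stateWeight ω n)) (G.traj u n z) ∂(G.law η)
        + ∫ z, wsq (G.stateWeight ω n) (stateNoise n z) ∂(G.law η) := by
  have hx := memLp_traj hu2 n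
  have hw := G.memLp_stateNoise η n
  have hAx := memLp_toEuclideanLin G.A hx
  have hBu := memLp_toEuclideanLin G.B (hu2 n)
  have hs : MemLp (fun z => Matrix.toEuclideanLin G.A (G.traj u n z) +
      Matrix.toEuclideanLin G.B (u n z)) 2 (G.law η) := hAx.add hBu
  have hv : MemLp (fun z => u n z + Matrix.toEuclideanLin (G.stageGain ω n) (G.traj u n z)) 2
    (G.law η) := (hu2 n).add (memLp_toEuclideanLin _ hx)
  have horth : mom (G.law η) (fun z => Matrix.toEuclideanLin G.A (G.traj u n z) +
      Matrix.toEuclideanLin G.B (u n z)) (stateNoise n) = 0 := by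
    rw [mom_add_left hAx hBu hw, mom_toEuclideanLin_left _ hx hw,
      mom_toEuclideanLin_left _ (hu2 n) hw, mom_eq_zero_comm (mom_stateNoise_traj hu hu2 n),
      mom_eq_zero_comm (mom_stateNoise_adapted le_rfl (hu n)), Matrix.mul_zero, Matrix.mul_zero,
      add_zero]
  simp only [traj_succ]
  rw [integral_wsq_add_of_mom_eq_zero _ hs hw horth, add_right_comm,
    ← integral_add (integrable_wsq _ hs) (integrable_wsq _ (hu2 n)),
    ← integral_add (integrable_wsq _ hv) (integrable_wsq _ hx)]
  simp only [G.complete_square hR (G.stateWeight_posSemidef hQ hR n)]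
  rfl

/-- Telescoping of `integral_stage`: the cost accumulated up to `N` plus the Riccati cost to go. At
`N = κ` the latter vanishes. -/
theorem sum_cost (hQ : (G.Q ω).PosSemidef) (hR : (G.R ω).PosDef)
    {u : ℕ → Sample κ m → Vec r} (hu : ∀ n, Measurable[G.obsAlg η n] (u n))
    (hu2 : ∀ n, MemLp (u n) 2 (G.law η)) {N : ℕ} (hN : N ≤ κ) :
    ∑ n ∈ Finset.range N, (∫ z, wsq (G.Q ω) (G.traj u (n + 1) z) ∂(G.law η)
        + ∫ z, wsq (G.R ω) (u n z) ∂(G.law η))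
      + ∫ z, wsq (G.riccati ω (κ - N)) (G.traj u N z) ∂(G.law η) =
    ∫ z, wsq (G.riccati ω κ) z.1 ∂(G.law η) +
      ∑ n ∈ Finset.range N, (∫ z, wsq (G.stateWeight ω n) (stateNoise n z) ∂(G.law η) +
        ∫ z, wsq (G.stageWeight ω n)
          (u n z + Matrix.toEuclideanLin (G.stageGain ω n) (G.traj u n z)) ∂(G.law η)) := by
  induction N with
  | zero => simp [traj, free, driven]
  | succ N ih =>
    have h1 := ih (by omega)
    have h2 := integral_stage hQ hR hu hu2 N
    have h3 : ∫ z, wsq (G.stateWeight ω N) (G.traj u (N + 1) z) ∂(G.law η) =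
        ∫ z, wsq (G.Q ω) (G.traj u (N + 1) z) ∂(G.law η) +
          ∫ z, wsq (G.riccati ω (κ - (N + 1))) (G.traj u (N + 1) z) ∂(G.law η) := by
      rw [← integral_add (integrable_wsq _ (memLp_traj hu2 _))
        (integrable_wsq _ (memLp_traj hu2 _))]
      simp only [stateWeight, wsq, Matrix.add_mulVec, dotProduct_add]
    have h4 : κ - N = (κ - (N + 1)) + 1 := by omega
    rw [h4, riccati] at h1
    rw [stateWeight] at h2
    rw [Finset.sum_range_succ, Finset.sum_range_succ]
    rw [stateWeight] at h3 ⊢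
    linarith

/-- The part of the cost of the follower that does not depend on the policy. -/
def baseCost (G : Game κ m r Ω) (η : SignalingRule κ m) (ω : Option Ω) : ℝ :=
  ∫ z, wsq (G.riccati ω κ) z.1 ∂(G.law η) +
    ∑ n ∈ Finset.range κ, (∫ z, wsq (G.stateWeight ω n) (stateNoise n z) ∂(G.law η) +
      ∫ z, wsq (G.stageWeight ω n) (Matrix.toEuclideanLin (G.stageGain ω n)
        (G.free n z - G.estimate η n z)) ∂(G.law η))

/-- The deviation of the inputs `u` from the certainty-equivalent feedback. -/
def deviation (G : Game κ m r Ω) (η : SignalingRule κ m) (ω : Option Ω)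
    (u : ℕ → Sample κ m → Vec r) (n : ℕ) (z : Sample κ m) : Vec r :=
  u n z + Matrix.toEuclideanLin (G.stageGain ω n) (G.estimate η n z + G.driven u n z)

theorem memLp_deviation {u : ℕ → Sample κ m → Vec r} (hu2 : ∀ n, MemLp (u n) 2 (G.law η))
    (n : ℕ) : MemLp (G.deviation η ω u n) 2 (G.law η) :=
  (hu2 n).add (memLp_toEuclideanLin _ ((G.memLp_estimate η n).add (G.memLp_driven hu2 n)))

theorem measurable_deviation {u : ℕ → Sample κ m → Vec r}
    (hu : ∀ n, Measurable[G.obsAlg η n] (u n)) (n : ℕ) :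
    Measurable[G.obsAlg η n] (G.deviation η ω u n) :=
  (hu n).add ((measurable_toEuclideanLin _).comp ((G.measurable_estimate η n).add
    (G.measurable_driven_obsAlg η hu (by omega))))

/-- In `sum_cost` the term `u + K x` equals `K` times the estimation error plus `deviation`. The
deviation is a function of the signals, hence orthogonal to the error, so only its own square
depends on the policy. -/
theorem sum_cost_eq (hQ : (G.Q ω).PosSemidef) (hR : (G.R ω).PosDef)
    {u : ℕ → Sample κ m → Vec r} (hu : ∀ n, Measurable[G.obsAlg η n] (u n))
    (hu2 : ∀ n, MemLp (u n) 2 (G.law η)) :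
    ∑ n ∈ Finset.range κ, (∫ z, wsq (G.Q ω) (G.traj u (n + 1) z) ∂(G.law η)
        + ∫ z, wsq (G.R ω) (u n z) ∂(G.law η)) = G.baseCost η ω +
      ∑ n ∈ Finset.range κ, ∫ z, wsq (G.stageWeight ω n) (G.deviation η ω u n z) ∂(G.law η) := by
  have h := sum_cost hQ hR hu hu2 le_rfl
  rw [Nat.sub_self, riccati] at h
  have h0 : ∫ z, wsq (0 : Matrix (Fin m) (Fin m) ℝ) (G.traj u κ z) ∂(G.law η) = 0 := by
    simp [wsq]
  rw [h0, add_zero] at h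
  rw [h, baseCost, add_assoc, ← Finset.sum_add_distrib]
  congr 1
  refine Finset.sum_congr rfl fun n _ => ?_
  rw [add_assoc]
  congr 1
  have he : MemLp (fun z => G.free n z - G.estimate η n z) 2 (G.law η) :=
    (G.memLp_free η n).sub (G.memLp_estimate η n)
  rw [← integral_wsq_add_of_mom_eq_zero _ (memLp_toEuclideanLin _ he) (memLp_deviation hu2 n)]
  · refine integral_congr_ae (Filter.Eventually.of_forall fun z => ?_)
    simp only [deviation, traj, map_add, map_sub]
    congr 1
    abel
  · rw [mom_toEuclideanLin_left _ he (memLp_deviation hu2 n),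
      G.mom_sub_estimate η n (measurable_deviation hu n) (memLp_deviation hu2 n), Matrix.mul_zero]

theorem stateCost_eq_sum (W : Matrix (Fin m) (Fin m) ℝ) (γ : ControlPolicy κ m r) :
    G.stateCost W η γ = ∑ n ∈ Finset.range κ,
      ∫⁻ z, ENNReal.ofReal (wsq W (G.traj (G.input η γ) (n + 1) z)) ∂(G.law η) := by
  rw [← Fin.sum_univ_eq_sum_range (fun n =>
    ∫⁻ z, ENNReal.ofReal (wsq W (G.traj (G.input η γ) (n + 1) z)) ∂(G.law η))]
  simp only [stateCost, state_eq, traj]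

theorem controlCost_eq_sum (W : Matrix (Fin r) (Fin r) ℝ) (γ : ControlPolicy κ m r) :
    G.controlCost W η γ = ∑ n ∈ Finset.range κ,
      ∫⁻ z, ENNReal.ofReal (wsq W (G.input η γ n z)) ∂(G.law η) := by
  rw [← Fin.sum_univ_eq_sum_range (fun n =>
    ∫⁻ z, ENNReal.ofReal (wsq W (G.input η γ n z)) ∂(G.law η))]
  simp only [controlCost, input_fin]

theorem memLp_input_of_followerCost_lt_top (hR : (G.R ω).PosDef) {γ : ControlPolicy κ m r}
    (h : G.followerCost ω η γ < ∞) (n : ℕ) : MemLp (G.input η γ n) 2 (G.law η) := by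
  by_cases hn : n < κ
  · refine memLp_of_lintegral_wsq_lt_top hR
      ((G.measurable_input η γ n).mono (G.obsAlg_le η n) le_rfl) ?_
    have h1 : G.controlCost (G.R ω) η γ < ∞ := lt_of_le_of_lt le_add_self h
    rw [controlCost_eq_sum] at h1
    exact ENNReal.sum_lt_top.1 h1 n (Finset.mem_range.2 hn)
  · have he : G.input η γ n = fun _ => 0 := by
      funext z; simp [input, hn]
    rw [he]
    exact MemLp.zero

theorem followerCost_eq (hQ : (G.Q ω).PosSemidef) (hR : (G.R ω).PosDef)
    {γ : ControlPolicy κ m r} (hu2 : ∀ n, MemLp (G.input η γ n) 2 (G.law η)) :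
    G.followerCost ω η γ = ENNReal.ofReal (G.baseCost η ω + ∑ n ∈ Finset.range κ,
      ∫ z, wsq (G.stageWeight ω n) (G.deviation η ω (G.input η γ) n z) ∂(G.law η)) := by
  rw [← sum_cost_eq hQ hR (G.measurable_input η γ) hu2, ENNReal.ofReal_sum_of_nonneg fun n _ =>
    add_nonneg (integral_wsq_nonneg hQ _) (integral_wsq_nonneg hR.posSemidef _), followerCost,
    stateCost_eq_sum, controlCost_eq_sum, ← Finset.sum_add_distrib]
  refine Finset.sum_congr rfl fun n _ => ?_
  rw [ENNReal.ofReal_add (integral_wsq_nonneg hQ _) (integral_wsq_nonneg hR.posSemidef _),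
    lintegral_wsq hQ (memLp_traj hu2 _), lintegral_wsq hR.posSemidef (hu2 n)]

variable (G η ω)

/-- The driven part of the state under the optimal inputs. -/
def optDriven : ℕ → Sample κ m → Vec m
  | 0, _ => 0
  | n + 1, z => Matrix.toEuclideanLin G.A (optDriven n z) + Matrix.toEuclideanLin G.B
      (-Matrix.toEuclideanLin (G.stageGain ω n) (G.estimate η n z + optDriven n z))

/-- The optimal inputs of the type-`ω` follower. -/
def optInput (n : ℕ) (z : Sample κ m) : Vec r :=
  -Matrix.toEuclideanLin (G.stageGain ω n) (G.estimate η n z + G.optDriven η ω n z)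

/-- Closes the feedback loop: `optInput` is defined through `optDriven`, which has to be the driven
part that these inputs generate. -/
theorem driven_optInput (n : ℕ) : G.driven (G.optInput η ω) n = G.optDriven η ω n := by
  induction n with
  | zero => rfl
  | succ n ih => rw [driven_succ, ih]; rfl

theorem measurable_optDriven {n k : ℕ} (h : n ≤ k + 1) :
    Measurable[G.obsAlg η k] (G.optDriven η ω n) := by
  induction n with
  | zero => exact measurable_const
  | succ n ih =>
    refine ((measurable_toEuclideanLin _).comp (ih (by omega))).add
      ((measurable_toEuclideanLin _).comp (((measurable_toEuclideanLin _).comp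
        (Measurable.add ?_ (ih (by omega)))).neg))
    exact (G.measurable_estimate η n).mono (G.obsAlg_mono η (by omega)) le_rfl

theorem measurable_optInput (n : ℕ) : Measurable[G.obsAlg η n] (G.optInput η ω n) :=
  ((measurable_toEuclideanLin _).comp ((G.measurable_estimate η n).add
    (G.measurable_optDriven η ω (by omega)))).neg

theorem memLp_optDriven (n : ℕ) : MemLp (G.optDriven η ω n) 2 (G.law η) := by
  induction n with
  | zero => exact MemLp.zero
  | succ n ih =>
    exact (memLp_toEuclideanLin _ ih).add (memLp_toEuclideanLin _
      (memLp_toEuclideanLin _ ((G.memLp_estimate η n).add ih)).neg)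

theorem memLp_optInput (n : ℕ) : MemLp (G.optInput η ω n) 2 (G.law η) :=
  (memLp_toEuclideanLin _ ((G.memLp_estimate η n).add (G.memLp_optDriven η ω n))).neg

theorem exists_policy_optInput :
    ∃ γ : ControlPolicy κ m r, ∀ n < κ, G.input η γ n = G.optInput η ω n :=
  G.exists_policy η (G.measurable_optInput η ω)

variable {G η ω}

theorem followerCost_of_input_eq (hQ : (G.Q ω).PosSemidef) (hR : (G.R ω).PosDef)
    {γ : ControlPolicy κ m r} (h : ∀ n < κ, G.input η γ n = G.optInput η ω n) :
    G.followerCost ω η γ = ENNReal.ofReal (G.baseCost η ω) := by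
  have hu2 : ∀ n, MemLp (G.input η γ n) 2 (G.law η) := fun n => by
    by_cases hn : n < κ
    · rw [h n hn]
      exact G.memLp_optInput η ω n
    · have he : G.input η γ n = fun _ => 0 := by
        funext z; simp [input, hn]
      rw [he]
      exact MemLp.zero
  rw [followerCost_eq hQ hR hu2, Finset.sum_eq_zero, add_zero]
  intro n hn
  have hn := Finset.mem_range.1 hn
  have h0 : ∀ z, G.deviation η ω (G.input η γ) n z = 0 := fun z => by
    rw [deviation, h n hn, G.driven_congr (v := G.optInput η ω) fun i hi => by
      rw [h i (by omega)], driven_optInput, optInput, neg_add_cancel]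
  simp [h0, wsq]

/-- A competitor of infinite cost loses trivially; one of finite cost has square-integrable inputs
and pays `baseCost` plus nonnegative squares. -/
theorem isBestResponse_of_input_eq (hQ : (G.Q ω).PosSemidef) (hR : (G.R ω).PosDef)
    {γ : ControlPolicy κ m r} (h : ∀ n < κ, G.input η γ n = G.optInput η ω n) :
    G.IsBestResponse ω η γ := by
  intro γ'
  rw [followerCost_of_input_eq hQ hR h]
  by_cases hfin : G.followerCost ω η γ' < ∞
  · rw [followerCost_eq hQ hR (memLp_input_of_followerCost_lt_top hR hfin)]
    exact ENNReal.ofReal_le_ofReal (le_add_of_nonneg_right (Finset.sum_nonneg fun n _ =>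
      integral_wsq_nonneg (G.stageWeight_posDef hQ hR n).posSemidef _))
  · rw [not_lt_top_iff.1 hfin]
    exact le_top

theorem baseCost_nonneg (hQ : (G.Q ω).PosSemidef) (hR : (G.R ω).PosDef) :
    0 ≤ G.baseCost η ω :=
  add_nonneg (integral_wsq_nonneg (G.riccati_posSemidef hQ hR _) _)
    (Finset.sum_nonneg fun n _ => add_nonneg
      (integral_wsq_nonneg (G.stateWeight_posSemidef hQ hR n) _)
      (integral_wsq_nonneg (G.stageWeight_posDef hQ hR n).posSemidef _))

theorem driven_ae_eq {u v : ℕ → Sample κ m → Vec r} {n : ℕ}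
    (h : ∀ i < n, u i =ᵐ[G.law η] v i) : G.driven u n =ᵐ[G.law η] G.driven v n := by
  have h' : ∀ᵐ z ∂(G.law η), ∀ i < n, u i z = v i z := by
    rw [ae_all_iff]
    intro i
    by_cases hi : i < n
    · filter_upwards [h i hi] with z hz _ using hz
    · exact Filter.Eventually.of_forall fun z hi' => absurd hi' hi
  filter_upwards [h'] with z hz
  exact G.driven_congr hz

/-- All best responses generate the same inputs almost surely. -/
theorem input_ae_eq_of_isBestResponse (hQ : (G.Q ω).PosSemidef) (hR : (G.R ω).PosDef)
    {γ : ControlPolicy κ m r} (hγ : G.IsBestResponse ω η γ) :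
    ∀ n < κ, G.input η γ n =ᵐ[G.law η] G.optInput η ω n := by
  obtain ⟨γ', hγ'⟩ := G.exists_policy_optInput η ω
  have hle := hγ γ'
  rw [followerCost_of_input_eq hQ hR hγ'] at hle
  have hu2 := memLp_input_of_followerCost_lt_top hR (hle.trans_lt ENNReal.ofReal_lt_top)
  rw [followerCost_eq hQ hR hu2, ENNReal.ofReal_le_ofReal_iff (baseCost_nonneg hQ hR)] at hle
  have hnn : ∀ n ∈ Finset.range κ, 0 ≤ ∫ z, wsq (G.stageWeight ω n)
      (G.deviation η ω (G.input η γ) n z) ∂(G.law η) := fun n _ =>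
    integral_wsq_nonneg (G.stageWeight_posDef hQ hR n).posSemidef _
  -- A best response pays no more than `baseCost`, so every squared deviation integrates to zero.
  have hsum := (Finset.sum_eq_zero_iff_of_nonneg hnn).1
    (le_antisymm (by linarith) (Finset.sum_nonneg hnn))
  -- The deviation at stage `n` contains the driven part, which depends on the earlier inputs; hence
  -- strong induction.
  intro n
  induction n using Nat.strong_induction_on with
  | _ n ih =>
    intro hn
    have h0 := ae_eq_zero_of_integral_wsq_eq_zero (G.stageWeight_posDef hQ hR n)
      (memLp_deviation hu2 n) (hsum n (Finset.mem_range.2 hn))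
    have hd := driven_ae_eq fun i hi => ih i hi (by omega)
    rw [driven_optInput] at hd
    filter_upwards [h0, hd] with z hz hdz
    rw [deviation, hdz] at hz
    exact eq_neg_of_add_eq_zero_left hz

/-- The weight `W` is free because the leader evaluates every type with the controller's weight, not
with the one that the type minimizes. -/
theorem stateCost_of_isBestResponse (hQ : (G.Q ω).PosSemidef) (hR : (G.R ω).PosDef)
    {γ : ControlPolicy κ m r} (hγ : G.IsBestResponse ω η γ) {W : Matrix (Fin m) (Fin m) ℝ}
    (hW : W.PosSemidef) :
    G.stateCost W η γ = ∑ n ∈ Finset.range κ,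
      ENNReal.ofReal (∫ z, wsq W (G.traj (G.optInput η ω) (n + 1) z) ∂(G.law η)) := by
  rw [stateCost_eq_sum]
  refine Finset.sum_congr rfl fun n hn => ?_
  have hn := Finset.mem_range.1 hn
  rw [← lintegral_wsq hW (memLp_traj (G.memLp_optInput η ω) _)]
  refine lintegral_congr_ae ?_
  filter_upwards [driven_ae_eq (n := n + 1) fun i hi =>
    input_ae_eq_of_isBestResponse hQ hR hγ i (by omega)] with z hz
  rw [traj, traj, hz]

theorem controlCost_of_isBestResponse (hQ : (G.Q ω).PosSemidef) (hR : (G.R ω).PosDef)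
    {γ : ControlPolicy κ m r} (hγ : G.IsBestResponse ω η γ) {W : Matrix (Fin r) (Fin r) ℝ}
    (hW : W.PosSemidef) :
    G.controlCost W η γ = ∑ n ∈ Finset.range κ,
      ENNReal.ofReal (∫ z, wsq W (G.optInput η ω n z) ∂(G.law η)) := by
  rw [controlCost_eq_sum]
  refine Finset.sum_congr rfl fun n hn => ?_
  rw [← lintegral_wsq hW (G.memLp_optInput η ω n)]
  refine lintegral_congr_ae ?_
  filter_upwards [input_ae_eq_of_isBestResponse hQ hR hγ n (Finset.mem_range.1 hn)] with z hz
  rw [hz]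

end Follower

end Game

end SensorDesign

/-! ### The leader's cost as a function of the estimate covariances -/

namespace SensorDesign

variable {κ m r : ℕ} {Ω : Type*}

namespace Game

variable (G : Game κ m r Ω)

/-- The covariance of the control-free state. -/
def freeCov : ℕ → Matrix (Fin m) (Fin m) ℝ
  | 0 => G.covInit
  | n + 1 => G.A * freeCov n * G.Aᵀ + G.covNoise

/-- The covariance of the one-step prediction, from the covariances `H` of the estimates. -/
def priorCov (H : ℕ → Matrix (Fin m) (Fin m) ℝ) : ℕ → Matrix (Fin m) (Fin m) ℝ
  | 0 => 0
  | n + 1 => G.A * H n * G.Aᵀ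

/-- The cross moments of the control-free state and the optimally driven part, from the
covariances `H` of the estimates. -/
def crossMom (ω : Option Ω) (H : ℕ → Matrix (Fin m) (Fin m) ℝ) : ℕ → Matrix (Fin m) (Fin m) ℝ
  | 0 => 0
  | n + 1 => G.A * (crossMom ω H n * G.Aᵀ - (H n + crossMom ω H n) * (G.stageGain ω n)ᵀ * G.Bᵀ)

/-- The second moments of the optimally driven part, from the covariances `H` of the estimates. -/
def drivenMom (ω : Option Ω) (H : ℕ → Matrix (Fin m) (Fin m) ℝ) : ℕ → Matrix (Fin m) (Fin m) ℝ
  | 0 => 0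
  | n + 1 =>
    G.A * drivenMom ω H n * G.Aᵀ
      - G.A * (((G.crossMom ω H n)ᵀ + drivenMom ω H n) * (G.stageGain ω n)ᵀ) * G.Bᵀ
      - G.B * (G.stageGain ω n * (G.crossMom ω H n + drivenMom ω H n)) * G.Aᵀ
      + G.B * (G.stageGain ω n * (H n + G.crossMom ω H n + ((G.crossMom ω H n)ᵀ + drivenMom ω H n))
          * (G.stageGain ω n)ᵀ) * G.Bᵀ

/-- The second moments of the state under the optimal inputs. -/
def trajMom (ω : Option Ω) (H : ℕ → Matrix (Fin m) (Fin m) ℝ) (n : ℕ) :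
    Matrix (Fin m) (Fin m) ℝ :=
  G.freeCov n + G.crossMom ω H n + ((G.crossMom ω H n)ᵀ + G.drivenMom ω H n)

/-- The second moments of the optimal inputs. -/
def inputMom (ω : Option Ω) (H : ℕ → Matrix (Fin m) (Fin m) ℝ) (n : ℕ) :
    Matrix (Fin r) (Fin r) ℝ :=
  G.stageGain ω n * (H n + G.crossMom ω H n + ((G.crossMom ω H n)ᵀ + G.drivenMom ω H n))
    * (G.stageGain ω n)ᵀ

theorem continuous_crossMom (ω : Option Ω) (n : ℕ) :
    Continuous fun H => G.crossMom ω H n := by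
  induction n with
  | zero => exact continuous_const
  | succ n ih =>
    simp only [crossMom]
    fun_prop

theorem continuous_drivenMom (ω : Option Ω) (n : ℕ) :
    Continuous fun H => G.drivenMom ω H n := by
  induction n with
  | zero => exact continuous_const
  | succ n ih =>
    have := G.continuous_crossMom ω n
    simp only [drivenMom]
    fun_prop

theorem continuous_trajMom (ω : Option Ω) (n : ℕ) : Continuous fun H => G.trajMom ω H n := by
  have := G.continuous_crossMom ω n
  have := G.continuous_drivenMom ω n
  unfold trajMom
  fun_prop

theorem continuous_inputMom (ω : Option Ω) (n : ℕ) : Continuous fun H => G.inputMom ω H n := by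
  have := G.continuous_crossMom ω n
  have := G.continuous_drivenMom ω n
  unfold inputMom
  fun_prop

variable {G} {η : SignalingRule κ m} {ω : Option Ω} {H : ℕ → Matrix (Fin m) (Fin m) ℝ}

theorem mom_free_free (hInit : G.covInit.PosSemidef) (hNoise : G.covNoise.PosSemidef) {n : ℕ}
    (hn : n ≤ κ) : mom (G.law η) (G.free n) (G.free n) = G.freeCov n := by
  induction n with
  | zero => exact mom_fst_fst hInit
  | succ n ih =>
    have hx := G.memLp_free η n
    have hw := G.memLp_stateNoise η n
    have hAx := memLp_toEuclideanLin G.A hx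
    have hs : MemLp (fun z => Matrix.toEuclideanLin G.A (G.free n z) + stateNoise n z) 2
      (G.law η) := hAx.add hw
    rw [free_succ, mom_add_left hAx hw hs, mom_add_right hAx hAx hw, mom_add_right hw hAx hw,
      mom_toEuclideanLin_left _ hx hAx, mom_toEuclideanLin_right _ hx hx,
      mom_toEuclideanLin_left _ hx hw, mom_toEuclideanLin_right _ hw hx, mom_free_stateNoise le_rfl,
      mom_eq_zero_comm (mom_free_stateNoise le_rfl), mom_stateNoise_self hNoise hn, ih (by omega),
      freeCov, mul_zero, zero_mul, add_zero, zero_add, Matrix.mul_assoc]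

theorem mom_free_of_adapted {e n : ℕ} {h : Sample κ m → Vec e} (hh : Measurable[G.obsAlg η n] h)
    (hh2 : MemLp h 2 (G.law η)) :
    mom (G.law η) (G.free n) h = mom (G.law η) (G.estimate η n) h := by
  have := G.mom_sub_estimate η n hh hh2
  rwa [mom_sub_left (G.memLp_free η n) (G.memLp_estimate η n) hh2, sub_eq_zero] at this

theorem mom_free_estimate (n : ℕ) : mom (G.law η) (G.free n) (G.estimate η n) =
    mom (G.law η) (G.estimate η n) (G.estimate η n) :=
  mom_free_of_adapted (G.measurable_estimate η n) (G.memLp_estimate η n)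

/-- The optimally driven part is a function of the signals, so the projection may be dropped.
Together with `mom_free_estimate`, this closes the moment recursions in terms of `H` alone. -/
theorem mom_estimate_optDriven (n : ℕ) :
    mom (G.law η) (G.estimate η n) (G.optDriven η ω n) =
      mom (G.law η) (G.free n) (G.optDriven η ω n) :=
  (mom_free_of_adapted (G.measurable_optDriven η ω (by omega)) (G.memLp_optDriven η ω n)).symm

theorem optDriven_succ (n : ℕ) : G.optDriven η ω (n + 1) =
    fun z => Matrix.toEuclideanLin G.A (G.optDriven η ω n z) +
      Matrix.toEuclideanLin G.B (G.optInput η ω n z) := rfl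

theorem optInput_eq (n : ℕ) : G.optInput η ω n = fun z =>
    -Matrix.toEuclideanLin (G.stageGain ω n) (G.estimate η n z + G.optDriven η ω n z) := rfl

theorem memLp_estimate_add (n : ℕ) :
    MemLp (fun z => G.estimate η n z + G.optDriven η ω n z) 2 (G.law η) :=
  (G.memLp_estimate η n).add (G.memLp_optDriven η ω n)

theorem mom_optInput_right {e n : ℕ} {f : Sample κ m → Vec e} (hf : MemLp f 2 (G.law η)) :
    mom (G.law η) f (G.optInput η ω n) = -((mom (G.law η) f (G.estimate η n) +
      mom (G.law η) f (G.optDriven η ω n)) * (G.stageGain ω n)ᵀ) := by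
  rw [optInput_eq, mom_neg_right, mom_toEuclideanLin_right _ hf (memLp_estimate_add n),
    mom_add_right hf (G.memLp_estimate η n) (G.memLp_optDriven η ω n)]

theorem mom_free_optDriven
    (hH : ∀ n < κ, H n = mom (G.law η) (G.estimate η n) (G.estimate η n)) {n : ℕ} (hn : n ≤ κ) :
    mom (G.law η) (G.free n) (G.optDriven η ω n) = G.crossMom ω H n := by
  induction n with
  | zero => exact mom_zero_right _
  | succ n ih =>
    have hx := G.memLp_free η n
    have hw := G.memLp_stateNoise η n
    have hd := G.memLp_optDriven η ω n
    have hu := G.memLp_optInput η ω n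
    have hd' := G.memLp_optDriven η ω (n + 1)
    rw [free_succ, mom_add_left (memLp_toEuclideanLin _ hx) hw hd',
      mom_stateNoise_adapted le_rfl (G.measurable_optDriven η ω le_rfl), add_zero,
      mom_toEuclideanLin_left _ hx hd', optDriven_succ, mom_add_right hx
      (memLp_toEuclideanLin _ hd) (memLp_toEuclideanLin _ hu), mom_toEuclideanLin_right _ hx hd,
      mom_toEuclideanLin_right _ hx hu, mom_optInput_right hx, ih (by omega), mom_free_estimate,
      ← hH n hn, crossMom, Matrix.neg_mul, ← sub_eq_add_neg]

theorem mom_optInput_optInput {n : ℕ} :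
    mom (G.law η) (G.optInput η ω n) (G.optInput η ω n) = G.stageGain ω n *
      (mom (G.law η) (G.estimate η n) (G.estimate η n) +
        mom (G.law η) (G.free n) (G.optDriven η ω n) +
        ((mom (G.law η) (G.free n) (G.optDriven η ω n))ᵀ +
          mom (G.law η) (G.optDriven η ω n) (G.optDriven η ω n))) * (G.stageGain ω n)ᵀ := by
  have he := G.memLp_estimate η n
  have hd := G.memLp_optDriven η ω n
  have hs := memLp_estimate_add (G := G) (η := η) (ω := ω) n
  rw [optInput_eq, mom_neg_left, mom_neg_right, neg_neg,
    mom_toEuclideanLin_left _ hs (memLp_toEuclideanLin _ hs), mom_toEuclideanLin_right _ hs hs,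
    mom_add_left he hd hs, mom_add_right he he hd, mom_add_right hd he hd, mom_estimate_optDriven,
    ← mom_transpose (G.estimate η n) (G.optDriven η ω n), mom_estimate_optDriven, Matrix.mul_assoc]

theorem mom_optDriven_optDriven
    (hH : ∀ n < κ, H n = mom (G.law η) (G.estimate η n) (G.estimate η n)) {n : ℕ} (hn : n ≤ κ) :
    mom (G.law η) (G.optDriven η ω n) (G.optDriven η ω n) = G.drivenMom ω H n := by
  induction n with
  | zero => exact mom_zero_right _
  | succ n ih =>
    have hd := G.memLp_optDriven η ω n
    have hu := G.memLp_optInput η ω n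
    have hAd := memLp_toEuclideanLin G.A hd
    have hBu := memLp_toEuclideanLin G.B hu
    have hT := mom_free_optDriven (ω := ω) hH (show n ≤ κ by omega)
    have hdu : mom (G.law η) (G.optDriven η ω n) (G.optInput η ω n) =
        -(((G.crossMom ω H n)ᵀ + G.drivenMom ω H n) * (G.stageGain ω n)ᵀ) := by
      rw [mom_optInput_right hd, ih (by omega), ← mom_transpose (G.estimate η n),
        mom_estimate_optDriven, hT]
    have hud : mom (G.law η) (G.optInput η ω n) (G.optDriven η ω n) =
        -(G.stageGain ω n * (G.crossMom ω H n + G.drivenMom ω H n)) := by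
      have hZ : (G.drivenMom ω H n)ᵀ = G.drivenMom ω H n := by
        rw [← ih (by omega), mom_transpose]
      rw [← mom_transpose, hdu, Matrix.transpose_neg, Matrix.transpose_mul, Matrix.transpose_add,
        Matrix.transpose_transpose, Matrix.transpose_transpose, hZ]
    rw [optDriven_succ, mom_add_add hAd hBu hAd hBu, mom_toEuclideanLin_left _ hd hAd,
      mom_toEuclideanLin_left _ hd hBu,
      mom_toEuclideanLin_left _ hu hAd, mom_toEuclideanLin_left _ hu hBu,
      mom_toEuclideanLin_right _ hd hd, mom_toEuclideanLin_right _ hd hu,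
      mom_toEuclideanLin_right _ hu hd, mom_toEuclideanLin_right _ hu hu, hdu, hud,
      mom_optInput_optInput, hT, ih (by omega), ← hH n hn, drivenMom]
    simp only [Matrix.mul_assoc, Matrix.neg_mul, Matrix.mul_neg]
    abel

theorem mom_traj_optInput (hInit : G.covInit.PosSemidef) (hNoise : G.covNoise.PosSemidef)
    (hH : ∀ n < κ, H n = mom (G.law η) (G.estimate η n) (G.estimate η n)) {n : ℕ} (hn : n ≤ κ) :
    mom (G.law η) (G.traj (G.optInput η ω) n) (G.traj (G.optInput η ω) n) = G.trajMom ω H n := by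
  have hx := G.memLp_free η n
  have hd := G.memLp_optDriven η ω n
  have ht : G.traj (G.optInput η ω) n = fun z => G.free n z + G.optDriven η ω n z := by
    rw [← driven_optInput]; rfl
  rw [ht, mom_add_add hx hd hx hd,
    mom_free_free hInit hNoise hn, ← mom_transpose (G.free n) (G.optDriven η ω n),
    mom_free_optDriven hH hn, mom_optDriven_optDriven hH hn, trajMom]

theorem mom_optInput
    (hH : ∀ n < κ, H n = mom (G.law η) (G.estimate η n) (G.estimate η n)) {n : ℕ} (hn : n < κ) :
    mom (G.law η) (G.optInput η ω n) (G.optInput η ω n) = G.inputMom ω H n := by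
  rw [mom_optInput_optInput, mom_free_optDriven hH hn.le, mom_optDriven_optDriven hH hn.le,
    ← hH n hn, inputMom]

variable (G) in
/-- The state cost of the leader when the type-`ω` follower best responds, as a function of the
covariances `H` of the estimates. -/
def stateCostOf (ω : Option Ω) (H : ℕ → Matrix (Fin m) (Fin m) ℝ) : ℝ≥0∞ :=
  ∑ n ∈ Finset.range κ, ENNReal.ofReal (G.Q none * G.trajMom ω H (n + 1)).trace

variable (G) in
/-- The control cost of the leader when the controller best responds, as a function of the
covariances `H` of the estimates. -/
def controlCostOf (H : ℕ → Matrix (Fin m) (Fin m) ℝ) : ℝ≥0∞ :=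
  ∑ n ∈ Finset.range κ, ENNReal.ofReal (G.R none * G.inputMom none H n).trace

variable (G) in
/-- The cost of the leader under best responses, as a function of the covariances `H` of the
estimates. -/
def leaderCostOf [Fintype Ω] (H : ℕ → Matrix (Fin m) (Fin m) ℝ) : ℝ≥0∞ :=
  ⨆ p ∈ stdSimplex ℝ (Option Ω),
    (∑ ω : Ω, ENNReal.ofReal (p (some ω)) * G.stateCostOf (some ω) H)
      + ENNReal.ofReal (p none) * (G.stateCostOf none H + G.controlCostOf H)

/-- For fixed `p` the cost is continuous, since the moments are polynomial in finitely many `H n`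
and the coefficients are finite. A supremum of such functions is lower semicontinuous, which
suffices for a minimum on a compact set. -/
theorem lowerSemicontinuous_leaderCostOf [Fintype Ω] (G : Game κ m r Ω) :
    LowerSemicontinuous G.leaderCostOf := by
  refine lowerSemicontinuous_biSup fun p _ => Continuous.lowerSemicontinuous ?_
  have h1 : ∀ ω, Continuous (G.stateCostOf ω) := fun ω =>
    continuous_finsetSum _ fun n _ => ENNReal.continuous_ofReal.comp
      (Continuous.matrix_trace (continuous_const.matrix_mul (G.continuous_trajMom ω (n + 1))))
  have h2 : Continuous G.controlCostOf :=
    continuous_finsetSum _ fun n _ => ENNReal.continuous_ofReal.comp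
      (Continuous.matrix_trace (continuous_const.matrix_mul (G.continuous_inputMom none n)))
  exact (continuous_finsetSum _ fun ω _ =>
    (ENNReal.continuous_const_mul ENNReal.ofReal_ne_top).comp (h1 _)).add
      ((ENNReal.continuous_const_mul ENNReal.ofReal_ne_top).comp ((h1 _).add h2))

/-- The right side does not mention `γ`, and sees `η` only through `H`. Both claims of the main
theorem rest on this. -/
theorem leaderCost_of_isBestResponse [Fintype Ω] (hInit : G.covInit.PosSemidef)
    (hNoise : G.covNoise.PosSemidef) (hQ : ∀ ω, (G.Q ω).PosSemidef) (hR : ∀ ω, (G.R ω).PosDef)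
    {γ : Option Ω → ControlPolicy κ m r} (hγ : ∀ ω, G.IsBestResponse ω η (γ ω))
    (hH : ∀ n < κ, H n = mom (G.law η) (G.estimate η n) (G.estimate η n)) :
    G.leaderCost η γ = G.leaderCostOf H := by
  have h1 : ∀ ω, G.stateCost (G.Q none) η (γ ω) = G.stateCostOf ω H := fun ω => by
    rw [stateCost_of_isBestResponse (hQ ω) (hR ω) (hγ ω) (hQ none), stateCostOf]
    refine Finset.sum_congr rfl fun n hn => ?_
    rw [integral_wsq _ (memLp_traj (G.memLp_optInput η ω) _),
      mom_traj_optInput hInit hNoise hH (Finset.mem_range.1 hn)]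
  have h2 : G.controlCost (G.R none) η (γ none) = G.controlCostOf H := by
    rw [controlCost_of_isBestResponse (hQ none) (hR none) (hγ none) (hR none).posSemidef,
      controlCostOf]
    refine Finset.sum_congr rfl fun n hn => ?_
    rw [integral_wsq _ (G.memLp_optInput η none n), mom_optInput hH (Finset.mem_range.1 hn)]
  simp only [leaderCost, leaderCostOf, h1, h2]

/-! ### Necessary conditions on the estimate covariances, and compactness -/

variable (G) in
/-- The sequences of matrices that are the covariances of the estimates under some signaling
rule. -/
def attainable : Set (ℕ → Matrix (Fin m) (Fin m) ℝ) :=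
  {H | ∀ n, (n < κ → (H n).PosSemidef ∧ (G.freeCov n - H n).PosSemidef ∧
    (H n - G.priorCov H n).PosSemidef) ∧ (¬n < κ → H n = 0)}

variable (G η) in
/-- The covariances of the estimates. -/
def estimateCov (n : ℕ) : Matrix (Fin m) (Fin m) ℝ :=
  if n < κ then mom (G.law η) (G.estimate η n) (G.estimate η n) else 0

theorem estimateCov_of_lt {n : ℕ} (hn : n < κ) :
    G.estimateCov η n = mom (G.law η) (G.estimate η n) (G.estimate η n) := if_pos hn

/-- All three matrices are second moments: of the estimate, of the estimation error, and of the
update from the prediction `A` times the previous estimate to the new estimate (at stage `0` the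
prediction is zero). -/
theorem estimateCov_mem_attainable (hInit : G.covInit.PosSemidef)
    (hNoise : G.covNoise.PosSemidef) (η : SignalingRule κ m) :
    G.estimateCov η ∈ G.attainable := by
  intro n
  refine ⟨fun hn => ?_, fun hn => if_neg hn⟩
  have he := G.memLp_estimate η n
  have hx := G.memLp_free η n
  rw [estimateCov_of_lt hn]
  refine ⟨mom_self_posSemidef he, ?_, ?_⟩
  · have h := mom_self_posSemidef (μ := G.law η) (f := fun z => G.free n z - G.estimate η n z)
      (hx.sub he)
    rwa [mom_sub_sub hx he hx he, mom_free_free hInit hNoise hn.le,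
      ← mom_transpose (G.free n) (G.estimate η n), mom_free_estimate, mom_transpose, sub_self,
      sub_zero] at h
  · cases n with
    | zero =>
      rw [priorCov, sub_zero]
      exact mom_self_posSemidef he
    | succ k =>
      have hk := G.memLp_estimate η k
      have hxk := G.memLp_free η k
      have hAk := memLp_toEuclideanLin G.A hk
      have hmk : Measurable[G.obsAlg η (k + 1)] (G.estimate η k) :=
        (G.measurable_estimate η k).mono (G.obsAlg_mono η (by omega)) le_rfl
      -- The old estimate is a function of the new signals, so the new estimate may be replaced by
      -- the state `A x + w`; the noise drops out and `x` projects back to the old estimate.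
      have hcross : mom (G.law η) (G.estimate η (k + 1))
          (fun z => Matrix.toEuclideanLin G.A (G.estimate η k z)) =
          G.A * mom (G.law η) (G.estimate η k) (G.estimate η k) * G.Aᵀ := by
        rw [mom_toEuclideanLin_right _ he hk, ← mom_free_of_adapted hmk hk, free_succ,
          mom_add_left (memLp_toEuclideanLin _ hxk) (G.memLp_stateNoise η k) hk,
          mom_toEuclideanLin_left _ hxk hk,
          mom_stateNoise_adapted le_rfl (G.measurable_estimate η k), add_zero, mom_free_estimate]
      have hcross' : mom (G.law η) (fun z => Matrix.toEuclideanLin G.A (G.estimate η k z))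
          (G.estimate η (k + 1)) =
          G.A * mom (G.law η) (G.estimate η k) (G.estimate η k) * G.Aᵀ := by
        rw [← mom_transpose, hcross]
        simp only [Matrix.transpose_mul, Matrix.transpose_transpose, mom_transpose,
          Matrix.mul_assoc]
      have h := mom_self_posSemidef (μ := G.law η)
        (f := fun z => G.estimate η (k + 1) z - Matrix.toEuclideanLin G.A (G.estimate η k z))
        (he.sub hAk)
      rw [mom_sub_sub he hAk he hAk,
        hcross, hcross', mom_toEuclideanLin_left _ hk hAk, mom_toEuclideanLin_right _ hk hk,
        ← Matrix.mul_assoc, sub_self, sub_zero] at h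
      rwa [priorCov, estimateCov_of_lt (by omega)]

end Game

theorem isClosed_posSemidef {d : ℕ} : IsClosed {M : Matrix (Fin d) (Fin d) ℝ | M.PosSemidef} := by
  have h : {M : Matrix (Fin d) (Fin d) ℝ | M.PosSemidef} =
      {M | Mᵀ = M} ∩ ⋂ x : Fin d → ℝ, {M | 0 ≤ x ⬝ᵥ M *ᵥ x} := by
    ext M
    simp [Matrix.posSemidef_iff_dotProduct_mulVec, Matrix.IsHermitian]
  rw [h]
  refine (isClosed_eq (by fun_prop) continuous_id).inter (isClosed_iInter fun x => ?_)
  refine isClosed_le continuous_const ?_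
  simp only [dotProduct, Matrix.mulVec]
  fun_prop

/-- Testing `M` on `e_i ± e_j` bounds `2 |M i j|` by `M i i + M j j`, and the diagonal of `M` is
dominated by that of `S`. -/
theorem abs_apply_le_of_posSemidef {d : ℕ} {M S : Matrix (Fin d) (Fin d) ℝ} (hM : M.PosSemidef)
    (hS : (S - M).PosSemidef) (i j : Fin d) : |M i j| ≤ S i i + S j j := by
  have hij : M j i = M i j := by simpa using hM.isHermitian.apply i j
  have h1 := hM.dotProduct_mulVec_nonneg (Pi.single i 1 + Pi.single j 1)
  have h2 := hM.dotProduct_mulVec_nonneg (Pi.single i 1 - Pi.single j 1)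
  have h3 : M i i ≤ S i i := by simpa using hS.diag_nonneg (i := i)
  have h4 : M j j ≤ S j j := by simpa using hS.diag_nonneg (i := j)
  have h5 := hM.diag_nonneg (i := i)
  have h6 := hM.diag_nonneg (i := j)
  simp [Matrix.mulVec_add, Matrix.mulVec_sub, add_dotProduct, sub_dotProduct, hij] at h1 h2
  rw [abs_le]
  constructor <;> linarith

namespace Game

/-- The set is closed in the product topology and lies in a product of compact intervals, with
endpoints given by the diagonals of `freeCov`. Requiring `H n = 0` beyond the horizon makes the
remaining intervals trivial. -/
theorem isCompact_attainable {κ m r : ℕ} {Ω : Type*} (G : Game κ m r Ω) :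
    IsCompact G.attainable := by
  let b : ℕ → Fin m → Fin m → ℝ := fun n i j =>
    if n < κ then G.freeCov n i i + G.freeCov n j j else 0
  have hc : IsCompact (Set.pi Set.univ fun n => Set.pi Set.univ fun i => Set.pi Set.univ fun j =>
      Set.Icc (-b n i j) (b n i j) : Set (ℕ → Fin m → Fin m → ℝ)) :=
    isCompact_univ_pi fun n => isCompact_univ_pi fun i => isCompact_univ_pi fun j => isCompact_Icc
  refine hc.of_isClosed_subset ?_ ?_
  · have hset : G.attainable = ⋂ n, ({H | n < κ → (H n).PosSemidef ∧
        (G.freeCov n - H n).PosSemidef ∧ (H n - G.priorCov H n).PosSemidef} ∩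
          {H | ¬n < κ → H n = 0}) := by
      ext H
      simp [attainable]
    change IsClosed G.attainable
    rw [hset]
    refine isClosed_iInter fun n => IsClosed.inter ?_ ?_
    · by_cases hn : n < κ
      · have hp : Continuous fun H : ℕ → Matrix (Fin m) (Fin m) ℝ => G.priorCov H n := by
          cases n <;> simp only [priorCov] <;> fun_prop
        simp only [hn, true_imp_iff]
        exact (isClosed_posSemidef.preimage (continuous_apply n)).inter
          ((isClosed_posSemidef.preimage (continuous_const.sub (continuous_apply n))).inter
            (isClosed_posSemidef.preimage ((continuous_apply n).sub hp)))
      · simp [hn]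
    · by_cases hn : n < κ
      · simp [hn]
      · simp only [hn, not_false_eq_true, true_imp_iff]
        exact isClosed_eq (continuous_apply n) continuous_const
  · intro H hH n _ i _ j _
    by_cases hn : n < κ
    · obtain ⟨h1, h2, -⟩ := (hH n).1 hn
      simp only [b, hn, if_true]
      exact abs_le.1 (abs_apply_le_of_posSemidef h1 h2 i j)
    · simp [b, hn, (hH n).2 hn]

end Game

end SensorDesign

/-! ### Realization of attainable covariances by memoryless rules -/

namespace SensorDesign

open Matrix in
/-- A matrix dominated by `M` factors through `M`. -/
theorem exists_mul_eq_of_posSemidef {d : ℕ} {M D : Matrix (Fin d) (Fin d) ℝ} (hD : D.PosSemidef)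
    (hMD : (M - D).PosSemidef) :
    ∃ L : Matrix (Fin d) (Fin d) ℝ, M * L = D ∧ (D - Lᵀ * M * L).PosSemidef := by
  have hM : M.PosSemidef := by simpa using hD.add hMD
  have hMt : Mᵀ = M := by simpa using hM.isHermitian.eq
  have hDt : Dᵀ = D := by simpa using hD.isHermitian.eq
  -- Domination gives `ker M ⊆ ker D`. By symmetry the range of `M` is the orthogonal complement of
  -- its kernel, so it contains the columns of `D`.
  have hker : ∀ v : Fin d → ℝ, M *ᵥ v = 0 → D *ᵥ v = 0 := fun v hv => by
    have h1 := hMD.dotProduct_mulVec_nonneg v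
    have h2 := hD.dotProduct_mulVec_nonneg v
    rw [sub_mulVec, dotProduct_sub, hv, dotProduct_zero, zero_sub] at h1
    exact (hD.dotProduct_mulVec_zero_iff v).1 (le_antisymm (by linarith) h2)
  have hsymm : (toEuclideanLin M).IsSymmetric := isSymmetric_toEuclideanLin_iff.2 hM.isHermitian
  have hcol : ∀ j, ∃ y : Vec d, toEuclideanLin M y = WithLp.toLp 2 (fun i => D i j) := fun j => by
    rw [← LinearMap.mem_range, ← Submodule.orthogonal_orthogonal (LinearMap.range _),
      hsymm.orthogonal_range, Submodule.mem_orthogonal]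
    intro v hv
    have hDv := hker v.ofLp (by
      have := congrArg WithLp.ofLp (LinearMap.mem_ker.1 hv)
      simpa [toLpLin_apply] using this)
    have := congrFun hDv j
    rw [← hDt] at this
    simpa [PiLp.inner_apply, mulVec, dotProduct, mul_comm] using this
  choose y hy using hcol
  let L : Matrix (Fin d) (Fin d) ℝ := of fun i j => y j i
  have hL : M * L = D := by
    ext i j
    exact congrFun (congrArg WithLp.ofLp (hy j)) i
  refine ⟨L, hL, posSemidef_of_wsq ?_ fun v => ?_⟩
  · exact hD.isHermitian.sub (by simpa using isHermitian_conjTranspose_mul_mul L hM.isHermitian)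
  -- Testing `M - D` on `L v` and `D` on `L v - v` and adding gives exactly `v' D v - (L v)' D v`,
  -- which is the form of `D - L' M L` at `v` because `M L = D`.
  · have h1 := hMD.dotProduct_mulVec_nonneg (L *ᵥ v.ofLp)
    have h2 := hD.dotProduct_mulVec_nonneg (L *ᵥ v.ofLp - v.ofLp)
    have h3 : M *ᵥ (L *ᵥ v.ofLp) = D *ᵥ v.ofLp := by rw [mulVec_mulVec, hL]
    have h4 : v.ofLp ⬝ᵥ D *ᵥ (L *ᵥ v.ofLp) = (L *ᵥ v.ofLp) ⬝ᵥ D *ᵥ v.ofLp := by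
      rw [dotProduct_mulVec, ← mulVec_transpose, hDt, dotProduct_comm]
    have h5 : wsq (D - Lᵀ * M * L) v =
        v.ofLp ⬝ᵥ D *ᵥ v.ofLp - (L *ᵥ v.ofLp) ⬝ᵥ D *ᵥ v.ofLp := by
      rw [wsq, sub_mulVec, dotProduct_sub, Matrix.mul_assoc, ← mulVec_mulVec, hL,
        dotProduct_mulVec v.ofLp Lᵀ, vecMul_transpose]
    simp only [star_trivial, sub_mulVec, mulVec_sub, dotProduct_sub, sub_dotProduct, h3, h4]
      at h1 h2
    rw [h5]
    linarith

variable {κ m r : ℕ} {Ω : Type*}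

/-- The memoryless signaling rule with gains `L` and noise covariances `Θ`. -/
def memoryless (L : ℕ → Matrix (Fin m) (Fin m) ℝ) (Θ : Fin κ → Matrix (Fin m) (Fin m) ℝ)
    (hΘ : ∀ k, (Θ k).PosSemidef) : SignalingRule κ m where
  gain k i := if i.val = k.val then L k else 0
  noiseCov := Θ
  noiseCov_posSemidef := hΘ

namespace Game

variable {G : Game κ m r Ω} {η : SignalingRule κ m} {L H : ℕ → Matrix (Fin m) (Fin m) ℝ}

theorem obs_memoryless {Θ : Fin κ → Matrix (Fin m) (Fin m) ℝ} (hΘ : ∀ k, (Θ k).PosSemidef)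
    {n : ℕ} (hn : n < κ) (z : Sample κ m) : G.obs (memoryless L Θ hΘ) n z =
      Matrix.toEuclideanLin (L n)ᵀ (G.free n z) + signalNoise n z := by
  rw [obs, Finset.sum_eq_single n]
  · simp [SignalingRule.gainAt, memoryless, hn]
  · intro i _ hi
    have : (memoryless L Θ hΘ).gainAt n i = 0 := by
      unfold SignalingRule.gainAt
      split_ifs
      · simp [memoryless, hi]
      · rfl
    simp [this]
  · simp

variable (G η L) in
/-- The one-step prediction of the Kalman filter with innovation gain `1`. -/
def predict : ℕ → Sample κ m → Vec m
  | 0, _ => 0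
  | n + 1, z => Matrix.toEuclideanLin G.A
      (predict n z + (G.obs η n z - Matrix.toEuclideanLin (L n)ᵀ (predict n z)))

theorem isLin_predict (n : ℕ) : IsLin (G.predict η L n) := by
  induction n with
  | zero => exact IsLin.zero
  | succ n ih =>
    exact (ih.add ((G.isLin_obs η n).sub (ih.toEuclideanLin _))).toEuclideanLin _

theorem measurable_predict {n k : ℕ} (h : n ≤ k + 1) :
    Measurable[G.obsAlg η k] (G.predict η L n) := by
  induction n with
  | zero => exact measurable_const
  | succ n ih =>
    exact (measurable_toEuclideanLin _).comp ((ih (by omega)).add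
      ((G.measurable_obs_of_le η (by omega)).sub
        ((measurable_toEuclideanLin _).comp (ih (by omega)))))

theorem mom_predict_eq_zero {e n : ℕ} {f : Sample κ m → Vec e} (hf : IsLin f)
    (h : ∀ j < n, mom (G.law η) f (G.obs η j) = 0) :
    mom (G.law η) f (G.predict η L n) = 0 := by
  cases n with
  | zero => exact mom_zero_right _
  | succ k =>
    exact mom_eq_zero_of_uncorrelated hf (fun j hj => h j (by omega)) (measurable_predict le_rfl)

theorem mom_signalNoise_obs {j n : ℕ} (h : j < n) :
    mom (G.law η) (signalNoise n) (G.obs η j) = 0 :=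
  mom_obs_of_mom_free (isLin_signalNoise n)
    (fun i _ => mom_eq_zero_comm (mom_free_signalNoise i n)) (mom_signalNoise_of_ne (by omega))

/-- The prediction error. -/
def predictError (G : Game κ m r Ω) (η : SignalingRule κ m) (L : ℕ → Matrix (Fin m) (Fin m) ℝ)
    (n : ℕ) (z : Sample κ m) : Vec m := G.free n z - G.predict η L n z

/-- The innovation. -/
def innovation (G : Game κ m r Ω) (η : SignalingRule κ m) (L : ℕ → Matrix (Fin m) (Fin m) ℝ)
    (n : ℕ) (z : Sample κ m) : Vec m :=
  Matrix.toEuclideanLin (L n)ᵀ (G.predictError η L n z) + signalNoise n z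

/-- The filtering error. -/
def filterError (G : Game κ m r Ω) (η : SignalingRule κ m) (L : ℕ → Matrix (Fin m) (Fin m) ℝ)
    (n : ℕ) (z : Sample κ m) : Vec m := G.predictError η L n z - G.innovation η L n z

theorem isLin_predictError (n : ℕ) : IsLin (G.predictError η L n) :=
  (G.isLin_free n).sub (isLin_predict n)

theorem isLin_innovation (n : ℕ) : IsLin (G.innovation η L n) :=
  ((isLin_predictError n).toEuclideanLin _).add (isLin_signalNoise n)

theorem isLin_filterError (n : ℕ) : IsLin (G.filterError η L n) :=
  (isLin_predictError n).sub (isLin_innovation n)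

theorem mom_predictError_right {e n : ℕ} {f : Sample κ m → Vec e} (hf : MemLp f 2 (G.law η)) :
    mom (G.law η) f (G.predictError η L n) =
      mom (G.law η) f (G.free n) - mom (G.law η) f (G.predict η L n) :=
  mom_sub_right hf (G.memLp_free η n) (memLp_of_isLin (isLin_predict n))

theorem mom_innovation_right {e n : ℕ} {f : Sample κ m → Vec e} (hf : MemLp f 2 (G.law η)) :
    mom (G.law η) f (G.innovation η L n) =
      mom (G.law η) f (G.predictError η L n) * L n + mom (G.law η) f (signalNoise n) := by
  have he := memLp_of_isLin (G := G) (η := η) (isLin_predictError (G := G) (η := η) (L := L) n)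
  rw [show G.innovation η L n = fun z => Matrix.toEuclideanLin (L n)ᵀ (G.predictError η L n z)
    + signalNoise n z from rfl, mom_add_right hf (memLp_toEuclideanLin _ he)
    (memLp_of_isLin (isLin_signalNoise n)), mom_toEuclideanLin_right _ hf he,
    Matrix.transpose_transpose]

theorem mom_filterError_right {e n : ℕ} {f : Sample κ m → Vec e} (hf : MemLp f 2 (G.law η)) :
    mom (G.law η) f (G.filterError η L n) =
      mom (G.law η) f (G.predictError η L n) - mom (G.law η) f (G.innovation η L n) :=
  mom_sub_right hf (memLp_of_isLin (isLin_predictError n)) (memLp_of_isLin (isLin_innovation n))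

theorem mom_signalNoise_predictError (n : ℕ) :
    mom (G.law η) (signalNoise n) (G.predictError η L n) = 0 := by
  rw [mom_predictError_right (memLp_of_isLin (isLin_signalNoise n)),
    mom_eq_zero_comm (mom_free_signalNoise n n),
    mom_predict_eq_zero (isLin_signalNoise n) fun j hj => mom_signalNoise_obs hj, sub_zero]

theorem mom_stateNoise_filterError (n : ℕ) :
    mom (G.law η) (stateNoise n) (G.filterError η L n) = 0 := by
  have hw := G.memLp_stateNoise η n
  have h : mom (G.law η) (stateNoise n) (G.predictError η L n) = 0 := by
    rw [mom_predictError_right hw, mom_eq_zero_comm (mom_free_stateNoise le_rfl),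
      mom_stateNoise_adapted le_rfl (measurable_predict (by omega)), sub_zero]
  rw [mom_filterError_right hw, mom_innovation_right hw, h, mom_stateNoise_signalNoise, zero_mul,
    add_zero, sub_zero]

theorem freeCov_transpose (hInit : G.covInit.PosSemidef) (hNoise : G.covNoise.PosSemidef) (n : ℕ) :
    (G.freeCov n)ᵀ = G.freeCov n := by
  induction n with
  | zero => simpa [freeCov] using hInit.isHermitian.eq
  | succ n ih =>
    have h : G.covNoiseᵀ = G.covNoise := by simpa using hNoise.isHermitian.eq
    simp only [freeCov, Matrix.transpose_add, Matrix.transpose_mul, Matrix.transpose_transpose, ih,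
      h, Matrix.mul_assoc]

/-- The hypotheses on a memoryless rule that make its filter have estimate covariances `H`. -/
structure Generates (G : Game κ m r Ω) (η : SignalingRule κ m)
    (L H : ℕ → Matrix (Fin m) (Fin m) ℝ) : Prop where
  obs_eq : ∀ n < κ, ∀ z, G.obs η n z =
    Matrix.toEuclideanLin (L n)ᵀ (G.free n z) + signalNoise n z
  gain_eq : ∀ n < κ, (G.freeCov n - G.priorCov H n) * L n = H n - G.priorCov H n
  noiseCov_eq : ∀ n (hn : n < κ), η.noiseCov ⟨n, hn⟩ = H n - G.priorCov H n -
    (L n)ᵀ * (G.freeCov n - G.priorCov H n) * L n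

section Filter

variable (hg : Generates G η L H)
include hg

theorem Generates.obs_eq_innovation {n : ℕ} (hn : n < κ) (z : Sample κ m) :
    G.obs η n z = G.innovation η L n z +
      Matrix.toEuclideanLin (L n)ᵀ (G.predict η L n z) := by
  simp only [hg.obs_eq n hn, innovation, predictError, map_sub]
  abel

/-- The covariance of the innovation, `L' M L + Θ`, is tuned to coincide with its cross moment `M L`
with the prediction error. The innovation itself is then the linear projection of that error, and no
possibly singular matrix has to be inverted. -/
theorem Generates.mom_innovation {n : ℕ} (hn : n < κ)
    (hcov : mom (G.law η) (G.predictError η L n) (G.predictError η L n) =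
      G.freeCov n - G.priorCov H n) :
    mom (G.law η) (G.predictError η L n) (G.innovation η L n) = H n - G.priorCov H n ∧
    mom (G.law η) (G.innovation η L n) (G.innovation η L n) = H n - G.priorCov H n := by
  have he := memLp_of_isLin (G := G) (η := η) (isLin_predictError (G := G) (η := η) (L := L) n)
  have hν := memLp_of_isLin (G := G) (η := η) (isLin_innovation (G := G) (η := η) (L := L) n)
  have hθ := memLp_of_isLin (G := G) (η := η) (isLin_signalNoise n)
  have h1 : mom (G.law η) (G.predictError η L n) (G.innovation η L n) =
      H n - G.priorCov H n := by
    rw [mom_innovation_right he, mom_eq_zero_comm (mom_signalNoise_predictError n), hcov, add_zero,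
      hg.gain_eq n hn]
  have h2 : mom (G.law η) (signalNoise n) (G.innovation η L n) = η.noiseCov ⟨n, hn⟩ := by
    rw [mom_innovation_right hθ, mom_signalNoise_predictError, mom_signalNoise_self hn, zero_mul,
      zero_add]
  refine ⟨h1, ?_⟩
  nth_rewrite 1 [show G.innovation η L n = fun z => Matrix.toEuclideanLin (L n)ᵀ
    (G.predictError η L n z) + signalNoise n z from rfl]
  rw [mom_add_left (memLp_toEuclideanLin _ he) hθ hν, mom_toEuclideanLin_left _ he hν, h1, h2,
    hg.noiseCov_eq n hn, Matrix.mul_assoc, hg.gain_eq n hn]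
  abel

/-- The current signal is the innovation plus a function of earlier signals. The filtering error is
orthogonal to the former because the two moments in `mom_innovation` agree, and to the latter by
`horth`. -/
theorem Generates.mom_filterError_obs {n : ℕ} (hn : n < κ)
    (hcov : mom (G.law η) (G.predictError η L n) (G.predictError η L n) =
      G.freeCov n - G.priorCov H n)
    (horth : ∀ j < n, mom (G.law η) (G.predictError η L n) (G.obs η j) = 0) :
    ∀ j ≤ n, mom (G.law η) (G.filterError η L n) (G.obs η j) = 0 := by
  have he := memLp_of_isLin (G := G) (η := η) (isLin_predictError (G := G) (η := η) (L := L) n)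
  have hν := memLp_of_isLin (G := G) (η := η) (isLin_innovation (G := G) (η := η) (L := L) n)
  have hp := memLp_of_isLin (G := G) (η := η) (isLin_predict (G := G) (η := η) (L := L) n)
  have hε := memLp_of_isLin (G := G) (η := η) (isLin_filterError (G := G) (η := η) (L := L) n)
  have hlt : ∀ j < n, mom (G.law η) (G.filterError η L n) (G.obs η j) = 0 := fun j hj => by
    have hy := memLp_of_isLin (G := G) (η := η) (G.isLin_obs η j)
    rw [← mom_transpose, mom_filterError_right hy, mom_innovation_right hy,
      mom_eq_zero_comm (horth j hj), mom_eq_zero_comm (mom_signalNoise_obs hj), zero_mul, add_zero,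
      sub_zero, Matrix.transpose_zero]
  intro j hj
  rcases hj.lt_or_eq with hj | rfl
  · exact hlt j hj
  · obtain ⟨h1, h2⟩ := hg.mom_innovation hn hcov
    rw [funext (hg.obs_eq_innovation hn), mom_add_right hε hν (memLp_toEuclideanLin _ hp),
      mom_toEuclideanLin_right _ hε hp, mom_predict_eq_zero (isLin_filterError _) hlt, zero_mul,
      add_zero, ← mom_transpose, mom_filterError_right hν, h2, ← mom_transpose, h1, ← h2,
      mom_transpose, sub_self, Matrix.transpose_zero]

theorem Generates.mom_filterError {n : ℕ} (hn : n < κ)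
    (hcov : mom (G.law η) (G.predictError η L n) (G.predictError η L n) =
      G.freeCov n - G.priorCov H n) :
    mom (G.law η) (G.filterError η L n) (G.filterError η L n) = G.freeCov n - H n := by
  have he := memLp_of_isLin (G := G) (η := η) (isLin_predictError (G := G) (η := η) (L := L) n)
  have hν := memLp_of_isLin (G := G) (η := η) (isLin_innovation (G := G) (η := η) (L := L) n)
  obtain ⟨h1, h2⟩ := hg.mom_innovation hn hcov
  have h3 : mom (G.law η) (G.innovation η L n) (G.predictError η L n) = H n - G.priorCov H n := by
    rw [← mom_transpose, h1, ← h2, mom_transpose]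
  rw [show G.filterError η L n = fun z => G.predictError η L n z - G.innovation η L n z from rfl,
    mom_sub_sub he hν he hν, h1, h2, h3, hcov]
  abel

theorem Generates.predictError_succ {n : ℕ} (hn : n < κ) : G.predictError η L (n + 1) =
    fun z => Matrix.toEuclideanLin G.A (G.filterError η L n z) + stateNoise n z := by
  funext z
  simp only [predictError, free, predict, filterError, hg.obs_eq_innovation hn, map_sub, map_add]
  abel

/-- Kalman recursion: the filtering error has covariance `freeCov n - H n`, and passing it through
`A` and adding the state noise gives `freeCov (n+1) - A H n A'`. Orthogonality to past signals is
inherited from the filtering error. -/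
theorem Generates.predictError_spec (hInit : G.covInit.PosSemidef)
    (hNoise : G.covNoise.PosSemidef) {n : ℕ} (hn : n < κ) :
    mom (G.law η) (G.predictError η L n) (G.predictError η L n) = G.freeCov n - G.priorCov H n ∧
      ∀ j < n, mom (G.law η) (G.predictError η L n) (G.obs η j) = 0 := by
  induction n with
  | zero =>
    refine ⟨?_, fun j hj => absurd hj (by omega)⟩
    have h : G.predictError η L 0 = G.free 0 := by
      funext z; simp [predictError, predict]
    rw [h, mom_free_free hInit hNoise (Nat.zero_le κ), priorCov, sub_zero]
  | succ n ih =>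
    have hn' : n < κ := by omega
    obtain ⟨hcov, horth⟩ := ih hn'
    have hε := memLp_of_isLin (G := G) (η := η) (isLin_filterError (G := G) (η := η) (L := L) n)
    have hAε := memLp_toEuclideanLin G.A hε
    have hw := G.memLp_stateNoise η n
    rw [hg.predictError_succ hn']
    constructor
    · rw [mom_add_add hAε hw hAε hw, mom_toEuclideanLin_left _ hε hAε,
        mom_toEuclideanLin_right _ hε hε, mom_toEuclideanLin_left _ hε hw,
        mom_toEuclideanLin_right _ hw hε, mom_stateNoise_filterError,
        mom_eq_zero_comm (mom_stateNoise_filterError n), mom_stateNoise_self hNoise hn',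
        hg.mom_filterError hn' hcov, freeCov, priorCov]
      noncomm_ring
    · intro j hj
      have hy := memLp_of_isLin (G := G) (η := η) (G.isLin_obs η j)
      rw [mom_add_left hAε hw hy, mom_toEuclideanLin_left _ hε hy,
        hg.mom_filterError_obs hn' hcov horth j (by omega),
        mom_stateNoise_adapted (n := n) le_rfl (G.measurable_obs_of_le η (by omega)), mul_zero,
        add_zero]

theorem Generates.mom_estimate (hInit : G.covInit.PosSemidef)
    (hNoise : G.covNoise.PosSemidef) (hsymm : ∀ n < κ, (H n)ᵀ = H n) {n : ℕ} (hn : n < κ) :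
    mom (G.law η) (G.estimate η n) (G.estimate η n) = H n := by
  obtain ⟨hcov, horth⟩ := hg.predictError_spec hInit hNoise hn
  -- The filter's estimate: a function of the signals whose error is orthogonal to all measurable
  -- functions of them.
  let ξ : Sample κ m → Vec m := fun z => G.free n z - G.filterError η L n z
  have hξ_eq : ξ = fun z => G.predict η L n z +
      (G.obs η n z - Matrix.toEuclideanLin (L n)ᵀ (G.predict η L n z)) := by
    funext z
    simp only [ξ, filterError, hg.obs_eq_innovation hn, predictError]
    abel
  have hξm : Measurable[G.obsAlg η n] ξ := by
    rw [hξ_eq]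
    exact (measurable_predict (by omega)).add ((G.measurable_obs_of_le η le_rfl).sub
      ((measurable_toEuclideanLin _).comp (measurable_predict (by omega))))
  have hx := G.memLp_free η n
  have hε := memLp_of_isLin (G := G) (η := η) (isLin_filterError (G := G) (η := η) (L := L) n)
  have hξ : MemLp ξ 2 (G.law η) := hx.sub hε
  have hest := G.memLp_estimate η n
  have horth' : ∀ h : Sample κ m → Vec m, Measurable[G.obsAlg η n] h →
      mom (G.law η) (G.filterError η L n) h = 0 := fun h hh =>
    mom_eq_zero_of_uncorrelated (isLin_filterError n) (hg.mom_filterError_obs hn hcov horth) hh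
  have hproj : ∀ h : Sample κ m → Vec m, Measurable[G.obsAlg η n] h → MemLp h 2 (G.law η) →
      mom (G.law η) (G.free n) h = mom (G.law η) ξ h := fun h hh hh2 => by
    rw [mom_sub_left hx hε hh2, horth' h hh, sub_zero]
  -- Both `ξ` and the estimate represent the projection of the state, so their second moments agree;
  -- almost sure equality is not needed.
  have h1 : mom (G.law η) (G.estimate η n) (G.estimate η n) = mom (G.law η) ξ ξ := by
    rw [← mom_free_estimate, hproj _ (G.measurable_estimate η n) hest, ← mom_transpose,
      ← mom_free_of_adapted hξm hξ, hproj _ hξm hξ, mom_transpose]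
  have h2 : mom (G.law η) (G.filterError η L n) (G.free n) = G.freeCov n - H n := by
    rw [← hg.mom_filterError hn hcov]
    have := horth' ξ hξm
    rw [mom_sub_right hε hx hε, sub_eq_zero] at this
    exact this
  rw [h1, ← hproj ξ hξm hξ, mom_sub_right hx hx hε, mom_free_free hInit hNoise hn.le,
    ← mom_transpose, h2, Matrix.transpose_sub, freeCov_transpose hInit hNoise, hsymm n hn]
  abel

end Filter

theorem exists_signalingRule (hInit : G.covInit.PosSemidef) (hNoise : G.covNoise.PosSemidef)
    (hH : H ∈ G.attainable) :
    ∃ η : SignalingRule κ m, ∀ n < κ,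
      H n = mom (G.law η) (G.estimate η n) (G.estimate η n) := by
  have h : ∀ n, ∃ L : Matrix (Fin m) (Fin m) ℝ, n < κ →
      (G.freeCov n - G.priorCov H n) * L = H n - G.priorCov H n ∧
      (H n - G.priorCov H n - Lᵀ * (G.freeCov n - G.priorCov H n) * L).PosSemidef := fun n => by
    by_cases hn : n < κ
    · obtain ⟨-, h1, h2⟩ := (hH n).1 hn
      -- Here `M - D` is `freeCov n - H n` once the prior covariance cancels.
      obtain ⟨L, hL⟩ := exists_mul_eq_of_posSemidef (M := G.freeCov n - G.priorCov H n) h2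
        (by rwa [sub_sub_sub_cancel_right])
      exact ⟨L, fun _ => hL⟩
    · exact ⟨0, fun hn' => absurd hn' hn⟩
  choose L hL using h
  have hΘ := fun k : Fin κ => (hL k k.isLt).2
  have hg : Generates G (memoryless L _ hΘ) L H :=
    ⟨fun n hn z => obs_memoryless hΘ hn z, fun n hn => (hL n hn).1, fun n hn => rfl⟩
  exact ⟨_, fun n hn => (hg.mom_estimate hInit hNoise (fun n hn => by
    simpa using ((hH n).1 hn).1.isHermitian.eq) hn).symm⟩

end Game

end SensorDesign

end

/-! ### The main theorem -/

open SensorDesign SensorDesign.Game in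
theorem proposition2 {Ω : Type*} [Fintype Ω] {κ m r : ℕ} (G : SensorDesign.Game κ m r Ω)
    (hInit : G.covInit.PosSemidef) (hNoise : G.covNoise.PosSemidef)
    (hQ : ∀ ω, (G.Q ω).PosSemidef) (hR : ∀ ω, (G.R ω).PosDef) :
    (∀ (η : SensorDesign.SignalingRule κ m) (γ γ' : Option Ω → SensorDesign.ControlPolicy κ m r),
        (∀ ω, G.IsBestResponse ω η (γ ω)) → (∀ ω, G.IsBestResponse ω η (γ' ω)) →
          G.leaderCost η γ = G.leaderCost η γ') ∧
      ∃ (η : SensorDesign.SignalingRule κ m)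
        (γ : Option Ω → SensorDesign.SignalingRule κ m → SensorDesign.ControlPolicy κ m r),
        G.IsStackelbergEquilibrium η γ := by
  refine ⟨fun η γ γ' hγ hγ' => ?_, ?_⟩
  -- Both sides are the value of `leaderCostOf` at the same `estimateCov`.
  · rw [leaderCost_of_isBestResponse hInit hNoise hQ hR hγ fun n hn => estimateCov_of_lt hn,
      leaderCost_of_isBestResponse hInit hNoise hQ hR hγ' fun n hn => estimateCov_of_lt hn]
  · choose γ hγ using fun (ω : Option Ω) (η : SignalingRule κ m) => G.exists_policy_optInput η ω
    have hbest : ∀ ω η, G.IsBestResponse ω η (γ ω η) := fun ω η =>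
      isBestResponse_of_input_eq (hQ ω) (hR ω) (hγ ω η)
    -- The rule with zero gains and zero noise provides a point of the set.
    have hne : (G.attainable).Nonempty := ⟨_, estimateCov_mem_attainable hInit hNoise
      ⟨fun _ _ => 0, fun _ => 0, fun _ => Matrix.PosSemidef.zero⟩⟩
    obtain ⟨H, hH, hmin⟩ := (G.lowerSemicontinuous_leaderCostOf.lowerSemicontinuousOn
      G.attainable).exists_isMinOn hne G.isCompact_attainable
    obtain ⟨η, hη⟩ := exists_signalingRule hInit hNoise hH
    refine ⟨η, γ, hbest, fun η' => ?_⟩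
    rw [leaderCost_of_isBestResponse hInit hNoise hQ hR (fun ω => hbest ω η) hη,
      leaderCost_of_isBestResponse hInit hNoise hQ hR (fun ω => hbest ω η')
        fun n hn => estimateCov_of_lt hn]
    -- Any competing rule yields attainable covariances, over which `H` is minimal.
    exact hmin (estimateCov_mem_attainable hInit hNoise η')
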